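/- An instance of $\mathrm{CSP}(2,3)$ consists of variables $V=\{v_1,\dots,v_n\}$, the alphabet $\Sigma=\{0,1,2\}$, and a set $\mathcal C$ of constraints, where each $C\in\mathcal C$ is a $2$-element subset of $V$ and comes with a predicate $P_C:\Sigma^C\to\{\mathrm{sat},\mathrm{unsat}\}$. It is \emph{satisfiable} if there is an assignment $\alpha:V\to\Sigma$ with $P_C(\alpha|_C)=\mathrm{sat}$ for every $C\in\mathcal C$. It is \emph{complete} if every $2$-element subset of $V$ belongs to $\mathcal C$ and every predicate $P_C$ takes the value $\mathrm{unsat}$ at least once. \textbf{Theorem.} There is an $n^{O(\log n)}$-time algorithm that decides whether a given complete instance of $\mathrm{CSP}(2,3)$ on $n$ variables is satisfiable. That is, there are a single deterministic (multi-stack) Turing machine $M$, a function $T:\mathbb N\to\mathbb N$ and a constant $c$ such that $T(n)\le n^{c\log n}$ for all $n\ge 2$ and, for every $n\geq 0$ and every complete instance of $\mathrm{CSP}(2,3)$ on $n$ variables, $M$, given the instance ($n$ in unary, followed by the truth tables of the predicates $P_{\{v_i,v_j\}}$ arranged in an $n\times n$ matrix, with an all-$\mathrm{sat}$ table at the diagonal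 positions), halts after at most $T(n)$ steps and outputs $1$ if the instance is satisfiable and $0$ otherwise. -/

import Mathlib

/-- An instance of `CSP(k, r)` on the `n` variables `Fin n`: a set of constraints, each of which
is a `k`-set of variables (so each `k`-set carries at most one constraint), together with a
predicate `P_C : Σ ^ C → {sat, unsat}` for each constraint `C`, over the alphabet
`Σ = {0, …, r - 1}`. The value `true` stands for `sat` and `false` for `unsat`. -/
structure CSP (k r n : ℕ) where
  constraints : Finset (Finset (Fin n))
  card_eq : ∀ C ∈ constraints, C.card = k
  pred : ∀ C ∈ constraints, ((v : Fin n) → v ∈ C → Fin r) → Bool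

namespace CSP

/-- The assignment `α` satisfies every constraint, i.e. `P_C(α(C)) = sat` for every `C`, where
`α(C)` is the restriction of `α` to `C`. -/
def IsSatisfiedBy {k r n : ℕ} (I : CSP k r n) (α : Fin n → Fin r) : Prop :=
  ∀ (C : Finset (Fin n)) (hC : C ∈ I.constraints), I.pred C hC (fun v _ => α v) = true

def Satisfiable {k r n : ℕ} (I : CSP k r n) : Prop :=
  ∃ α : Fin n → Fin r, I.IsSatisfiedBy α

/-- An instance is complete if every `k`-set of variables carries a constraint and every
predicate has at least one unsatisfying input. -/
def IsComplete {k r n : ℕ} (I : CSP k r n) : Prop :=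
  (∀ C : Finset (Fin n), C.card = k → C ∈ I.constraints) ∧
    ∀ (C : Finset (Fin n)) (hC : C ∈ I.constraints),
      ∃ σ : (v : Fin n) → v ∈ C → Fin r, I.pred C hC σ = false

/-- For a binary instance: the value of the predicate of the constraint `{i, j}` at the labels
`a` for `i` and `b` for `j` (`true` if there is no constraint on `{i, j}`, in particular if
`i = j`). -/
def allows {r n : ℕ} (I : CSP 2 r n) (i j : Fin n) (a b : Fin r) : Bool :=
  if h : {i, j} ∈ I.constraints then
    I.pred {i, j} h (fun v _ => if v = i then a else b)
  else true

/-- The input word of a binary instance: the number `n` of variables in unary, terminated by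
`false`, followed by the `n × n` matrix, row by row, whose entry `(i, j)` is the `r × r` truth
table, row by row, of the predicate of `{i, j}`. -/
def encode {r n : ℕ} (I : CSP 2 r n) : List Bool :=
  List.replicate n true ++ false ::
    (List.finRange n).flatMap fun i =>
      (List.finRange n).flatMap fun j =>
        (List.finRange r).flatMap fun a =>
          (List.finRange r).map fun b => I.allows i j a b

end CSP

/-- The multi-stack Turing machine `M`, started on the word `x`, halts after at most `t` steps
with output the single bit `b`. -/
def OutputsBitInTime (M : Turing.TM2ComputableAux Bool Bool) (x : List Bool) (b : Bool)
    (t : ℕ) : Prop :=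
  Nonempty (Turing.TM2OutputsInTime M.tm (x.map M.inputAlphabet.symm)
    (some ([b].map M.outputAlphabet.symm)) t)

/-!
A complete instance of `CSP(2, 3)` is decided by branching, with arc consistency as the only means
of inference.

Keep for each variable a set of possible labels, and call a variable undecided if all three are
possible. Fix an undecided variable `u`. For every other variable `v` some pair of labels `u ↦ a`,
`v ↦ b` is forbidden, so that giving `u` the label `a` and restoring arc consistency makes `v`
decided. By counting, one of the three labels of `u` either leads to a contradiction or leaves less
than two thirds of the undecided variables undecided. Branch on all assignments `u ↦ a` with such a
shrinking label `a`: a solution that uses one of them survives in the corresponding branch, and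
every other solution survives when all contradictory and shrinking labels are deleted
(`solvable_iff`). After the deletion no variable is undecided (`numFull_prune`), and then at most
two labels remain for each variable. For such tables arc consistency decides solvability as in the
case of `2`-SAT: if for each variable there is a label whose consequences are free of
contradictions, the partial decisions obtained in this way can be merged one after the other into a
solution (`exists_merge`, `solvable_of_probes`). Since a branch has less than two thirds of the
undecided variables, and `3 / 2 > √2`, the search tree has at most `(3 n + 2) ^ log₂ (2 n²)` nodes
(`sum_weight_children`), each of which is processed in polynomial time.

The machine keeps the tables still to be searched on a stack. It is written as a structured program
(`Cmd`), whose positions become the labels of the machine (`code`, `machine_outputs`), and whose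
runs are described by rules for sequences, conditionals and loops. The data of the `n` variables
form one list of records that is only ever processed by passes from one stack to another
(`runs_pass`); nested loops over the variables move marks along that list (`runs_forEach`).
-/

namespace CompleteCSP

/-! ### Constraint tables and arc consistency -/

/-- A set of labels still possible for a variable. -/
abbrev Dom := Finset (Fin 3)

/-- A domain for each of the `n` variables: a partial decision about an assignment. -/
abbrev Table (n : ℕ) := Fin n → Dom

/-- The truth tables of a binary instance: `R i j a b` says that `i ↦ a`, `j ↦ b` is allowed. -/
abbrev Rel (n : ℕ) := Fin n → Fin n → Fin 3 → Fin 3 → Bool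

variable {n : ℕ}

/-- The assignment `α` takes its labels from the table `X` and is allowed on every pair. -/
def IsSolution (R : Rel n) (X : Table n) (α : Fin n → Fin 3) : Prop :=
  (∀ v, α v ∈ X v) ∧ ∀ i j, R i j (α i) (α j) = true

/-- Some allowed assignment takes its labels from the table `X`. -/
def Solvable (R : Rel n) (X : Table n) : Prop := ∃ α, IsSolution R X α

/-- The labels of the second variable that some label in `s` of the first one allows. -/
def support (f : Fin 3 → Fin 3 → Bool) (s : Dom) : Dom :=
  Finset.univ.filter fun b => ∃ a ∈ s, f a b = true

/-- Restrict every domain to the labels supported by the domain of `i`. -/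
def revise (R : Rel n) (X : Table n) (i : Fin n) : Table n :=
  fun j => X j ∩ support (R i j) (X i)

/-- Revise with respect to each variable in turn. -/
def sweep (R : Rel n) (X : Table n) : Table n :=
  (List.finRange n).foldl (revise R) X

/-- The arc-consistent closure. Each sweep before the last effective one removes a label, and there
are at most `3 * n` labels, so that `3 * n` sweeps suffice. -/
def arcClosure (R : Rel n) (X : Table n) : Table n := (sweep R)^[3 * n] X

/-- Every possible label of `j` is supported by some possible label of `i`. The case `i = j` is
included; it is harmless because an instance allows everything on the diagonal. -/
def ArcConsistent (R : Rel n) (X : Table n) : Prop :=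
  ∀ i j, ∀ b ∈ X j, ∃ a ∈ X i, R i j a b = true

theorem revise_le (R : Rel n) (X : Table n) (i : Fin n) : revise R X i ≤ X :=
  fun _ => Finset.inter_subset_left

theorem foldl_revise_le (R : Rel n) (l : List (Fin n)) (X : Table n) :
    l.foldl (revise R) X ≤ X := by
  induction l generalizing X with
  | nil => exact le_rfl
  | cons i l ih => exact (ih _).trans (revise_le R X i)

theorem sweep_le (R : Rel n) (X : Table n) : sweep R X ≤ X := foldl_revise_le R _ X

theorem revise_eq_of_foldl_eq (R : Rel n) (l : List (Fin n)) (X : Table n)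
    (h : l.foldl (revise R) X = X) : ∀ i ∈ l, revise R X i = X := by
  induction l with
  | nil => simp
  | cons i l ih =>
    have h1 : revise R X i = X := by
      refine le_antisymm (revise_le R X i) ?_
      conv_lhs => rw [← h]
      exact foldl_revise_le R l _
    rw [List.foldl_cons, h1] at h
    intro j hj
    rcases List.mem_cons.1 hj with rfl | hj
    · exact h1
    · exact ih h j hj

theorem arcConsistent_of_sweep_eq (R : Rel n) (X : Table n) (h : sweep R X = X) :
    ArcConsistent R X := by
  intro i j b hb
  have h1 := revise_eq_of_foldl_eq R _ X h i (List.mem_finRange i)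
  rw [← h1] at hb
  have h2 := (Finset.mem_inter.1 hb).2
  simpa [support] using h2

/-- A decreasing map of tables loses a label at each step until it reaches a fixed point. -/
theorem iterate_fixed_or_card (f : Table n → Table n) (hf : ∀ X, f X ≤ X) (X : Table n) (k : ℕ) :
    f (f^[k] X) = f^[k] X ∨ (∑ v, (f^[k] X v).card) + k ≤ ∑ v, (X v).card := by
  induction k with
  | zero => right; simp
  | succ k ih =>
    rw [Function.iterate_succ_apply']
    by_cases h : f (f^[k] X) = f^[k] X
    · left; rw [h, h]
    · right
      rcases ih with ih | ih
      · exact absurd ih h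
      · have hle := hf (f^[k] X)
        have hlt : f (f^[k] X) < f^[k] X := lt_of_le_of_ne hle h
        obtain ⟨v, hv⟩ := (Pi.lt_def.1 hlt).2
        have : ∑ v, (f (f^[k] X) v).card < ∑ v, (f^[k] X v).card :=
          Finset.sum_lt_sum (fun w _ => Finset.card_le_card (hle w))
            ⟨v, Finset.mem_univ v, Finset.card_lt_card hv⟩
        omega

theorem iterate_le (f : Table n → Table n) (hf : ∀ X, f X ≤ X) (X : Table n) (k : ℕ) :
    f^[k] X ≤ X := by
  induction k with
  | zero => exact le_rfl
  | succ k ih => rw [Function.iterate_succ_apply']; exact (hf _).trans ih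

theorem arcClosure_le (R : Rel n) (X : Table n) : arcClosure R X ≤ X :=
  iterate_le _ (sweep_le R) X _

theorem arcConsistent_arcClosure (R : Rel n) (X : Table n) :
    ArcConsistent R (arcClosure R X) := by
  apply arcConsistent_of_sweep_eq
  rcases iterate_fixed_or_card _ (sweep_le R) X (3 * n) with h | h
  · exact h
  · have h3 : ∑ v, (X v).card ≤ 3 * n := by
      calc ∑ v, (X v).card ≤ ∑ _v : Fin n, 3 :=
            Finset.sum_le_sum fun v _ => (Finset.card_le_univ (X v)).trans (by simp)
        _ = 3 * n := by simp [mul_comm]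
    -- no label is left, and the empty table is a fixed point
    have h0 : ∑ v, (arcClosure R X v).card = 0 := by
      change ∑ v, ((sweep R)^[3 * n] X v).card = 0
      omega
    refine le_antisymm (sweep_le R _) fun v => ?_
    have := (Finset.sum_eq_zero_iff.1 h0) v (Finset.mem_univ v)
    rw [Finset.card_eq_zero.1 this]
    exact Finset.empty_subset _

theorem IsSolution.mono {R : Rel n} {X Y : Table n} {α : Fin n → Fin 3} (h : IsSolution R X α)
    (hXY : X ≤ Y) : IsSolution R Y α :=
  ⟨fun v => hXY v (h.1 v), h.2⟩

theorem IsSolution.revise {R : Rel n} {X : Table n} {α : Fin n → Fin 3} (h : IsSolution R X α)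
    (i : Fin n) : IsSolution R (revise R X i) α := by
  refine ⟨fun v => Finset.mem_inter.2 ⟨h.1 v, ?_⟩, h.2⟩
  simpa [support] using ⟨α i, h.1 i, h.2 i v⟩

theorem IsSolution.sweep {R : Rel n} {X : Table n} {α : Fin n → Fin 3} (h : IsSolution R X α) :
    IsSolution R (sweep R X) α := by
  unfold CompleteCSP.sweep
  induction List.finRange n generalizing X with
  | nil => exact h
  | cons i l ih => exact ih (h.revise i)

theorem IsSolution.arcClosure {R : Rel n} {X : Table n} {α : Fin n → Fin 3}
    (h : IsSolution R X α) : IsSolution R (arcClosure R X) α := by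
  unfold CompleteCSP.arcClosure
  induction 3 * n with
  | zero => exact h
  | succ k ih => rw [Function.iterate_succ_apply']; exact ih.sweep

/-! ### The branching step -/

/-- Give `u` the label `a` if it is still possible, and no label otherwise. -/
def assign (D : Table n) (u : Fin n) (a : Fin 3) : Table n :=
  fun v => if v = u then D v ∩ {a} else D v

/-- The consequences, under arc consistency, of giving `u` the label `a`. -/
def probe (R : Rel n) (D : Table n) (u : Fin n) (a : Fin 3) : Table n :=
  arcClosure R (assign D u a)

/-- Some variable has no label left, so that the table is contradictory. -/
def HasEmpty (X : Table n) : Prop := ∃ v, X v = ∅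

instance (X : Table n) : Decidable (HasEmpty X) := inferInstanceAs (Decidable (∃ v, X v = ∅))

/-- The number of undecided variables, those with all three labels possible. -/
def numFull (X : Table n) : ℕ := (Finset.univ.filter fun v => X v = Finset.univ).card

/-- The label `a` at `u` settles more than a third of the undecided variables. -/
def Shrinks (R : Rel n) (D : Table n) (u : Fin n) (a : Fin 3) : Prop :=
  3 * numFull (probe R D u a) < 2 * numFull D

instance (R : Rel n) (D : Table n) (u : Fin n) (a : Fin 3) : Decidable (Shrinks R D u a) :=
  inferInstanceAs (Decidable (3 * numFull (probe R D u a) < 2 * numFull D))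

/-- The table left when every contradictory and every shrinking label has been removed. -/
def prune (R : Rel n) (D : Table n) : Table n :=
  fun u => (D u).filter fun a => ¬ (HasEmpty (probe R D u a) ∨ Shrinks R D u a)

/-- The branch for the label `a` at `u`, if there is one. -/
def branch (R : Rel n) (D : Table n) (u : Fin n) (a : Fin 3) : List (Table n) :=
  if ¬ HasEmpty (probe R D u a) ∧ Shrinks R D u a then [probe R D u a] else []

/-- The tables to branch on: one for each consistent shrinking label. -/
def branches (R : Rel n) (D : Table n) : List (Table n) :=
  (List.finRange n).flatMap fun u => (List.finRange 3).flatMap fun a => branch R D u a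

/-- The subproblems of a table: its branches, and the pruned table if anything was undecided. The
order is that in which they lie on the stack of the machine. -/
def children (R : Rel n) (D : Table n) : List (Table n) :=
  (if numFull D = 0 then [] else [prune R D]) ++ (branches R D).reverse

/-- A table without undecided variables is accepted at once if each variable has a label whose
consequences are not contradictory. -/
def Accepts (R : Rel n) (D : Table n) : Prop :=
  numFull D = 0 ∧ ∀ u, (prune R D u).Nonempty

theorem assign_le (D : Table n) (u : Fin n) (a : Fin 3) : assign D u a ≤ D := by
  intro v
  unfold assign
  split_ifs
  · exact Finset.inter_subset_left
  · exact le_rfl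

theorem probe_le (R : Rel n) (D : Table n) (u : Fin n) (a : Fin 3) : probe R D u a ≤ D :=
  (arcClosure_le R _).trans (assign_le D u a)

theorem probe_self_subset (R : Rel n) (D : Table n) (u : Fin n) (a : Fin 3) :
    probe R D u a u ⊆ {a} := by
  refine (arcClosure_le R _ u).trans ?_
  simp only [assign, if_true]
  exact Finset.inter_subset_right

theorem IsSolution.probe {R : Rel n} {D : Table n} {α : Fin n → Fin 3} (h : IsSolution R D α)
    (u : Fin n) : IsSolution R (probe R D u (α u)) α := by
  apply IsSolution.arcClosure
  refine ⟨fun v => ?_, h.2⟩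
  unfold assign
  split_ifs with hv
  · subst hv
    exact Finset.mem_inter.2 ⟨h.1 v, Finset.mem_singleton_self _⟩
  · exact h.1 v

theorem IsSolution.not_hasEmpty {R : Rel n} {X : Table n} {α : Fin n → Fin 3}
    (h : IsSolution R X α) : ¬ HasEmpty X := by
  rintro ⟨v, hv⟩
  have := h.1 v
  simp [hv] at this

theorem prune_le (R : Rel n) (D : Table n) : prune R D ≤ D := fun _ => Finset.filter_subset _ _

theorem mem_branches {R : Rel n} {D C : Table n} : C ∈ branches R D ↔
    ∃ u a, ¬ HasEmpty (probe R D u a) ∧ Shrinks R D u a ∧ C = probe R D u a := by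
  unfold branches branch
  simp only [List.mem_flatMap, List.mem_finRange, true_and]
  refine exists_congr fun u => exists_congr fun a => ?_
  split_ifs with h
  · simp [h.1, h.2]
  · simp only [List.not_mem_nil, false_iff]
    exact fun h' => h ⟨h'.1, h'.2.1⟩

/-! ### Two labels per variable -/

/-- Extending a partial decision: where the arc-consistent table `H` has fixed a label it is kept,
elsewhere `H` agrees with `D` and may be replaced by the consistent table `G`. -/
theorem exists_merge {R : Rel n} (hsymm : ∀ i j a b, R i j a b = R j i b a) {D G H : Table n}
    (hD : ∀ v, (D v).card ≤ 2) (hHD : H ≤ D) (hH : ArcConsistent R H) (hH0 : ∀ v, (H v).Nonempty)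
    (hGD : G ≤ D) (hG : ArcConsistent R G) (hG0 : ∀ v, (G v).Nonempty) :
    ∃ H' : Table n, H' ≤ D ∧ ArcConsistent R H' ∧ (∀ v, (H' v).Nonempty) ∧
      ∀ v, ((H v).card = 1 ∨ (G v).card = 1) → (H' v).card = 1 := by
  classical
  have key : ∀ v, (H v).card ≠ 1 → H v = D v := by
    intro v hv
    apply Finset.eq_of_subset_of_card_le (hHD v)
    have := (hH0 v).card_pos
    have := hD v
    omega
  refine ⟨fun v => if (H v).card = 1 then H v else G v, ?_, ?_, ?_, ?_⟩
  · intro v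
    dsimp only
    split_ifs
    · exact hHD v
    · exact hGD v
  · intro i j b hb
    dsimp only at hb ⊢
    by_cases hi : (H i).card = 1 <;> by_cases hj : (H j).card = 1 <;>
      simp only [hi, hj, if_true, if_false] at hb ⊢
    · exact hH i j b hb
    · exact hH i j b (by rw [key j hj]; exact hGD j hb)
    · -- `b` is the only label of `H j`, hence the one that supports a label of `G i`
      obtain ⟨a, ha⟩ := hG0 i
      have haH : a ∈ H i := by rw [key i hi]; exact hGD i ha
      obtain ⟨b', hb', hR⟩ := hH j i a haH
      obtain rfl : b' = b := Finset.card_le_one.1 hj.le _ hb' _ hb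
      exact ⟨a, ha, by rw [hsymm]; exact hR⟩
    · exact hG i j b hb
  · intro v
    dsimp only
    split_ifs
    · exact hH0 v
    · exact hG0 v
  · intro v hv
    dsimp only
    split_ifs with h
    · exact h
    · exact hv.resolve_left h

/-- For at most two labels per variable, probing one variable at a time decides solvability. -/
theorem solvable_of_probes {R : Rel n} (hsymm : ∀ i j a b, R i j a b = R j i b a) {D : Table n}
    (hD : ∀ v, (D v).card ≤ 2) (h : ∀ u, ∃ a, ¬ HasEmpty (probe R D u a)) : Solvable R D := by
  classical
  choose a ha using h
  have hne : ∀ u v, (probe R D u (a u) v).Nonempty := fun u v =>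
    Finset.nonempty_iff_ne_empty.2 fun h0 => ha u ⟨v, h0⟩
  rcases isEmpty_or_nonempty (Fin n) with hn | ⟨⟨u₀⟩⟩
  · exact ⟨fun v => hn.elim v, fun v => hn.elim v, fun v => hn.elim v⟩
  -- fix the labels of the variables in `S` one after the other, by merging their probes
  have main : ∀ S : Finset (Fin n), ∃ H : Table n, H ≤ D ∧ ArcConsistent R H ∧
      (∀ v, (H v).Nonempty) ∧ ∀ v ∈ S, (H v).card = 1 := by
    intro S
    induction S using Finset.induction with
    | empty => exact ⟨_, probe_le R D u₀ (a u₀), arcConsistent_arcClosure R _, hne u₀, by simp⟩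
    | insert u S _ ih =>
      obtain ⟨H, h1, h2, h3, h4⟩ := ih
      obtain ⟨H', g1, g2, g3, g4⟩ := exists_merge hsymm hD h1 h2 h3 (probe_le R D u (a u))
        (arcConsistent_arcClosure R _) (hne u)
      refine ⟨H', g1, g2, g3, fun v hv => g4 v ?_⟩
      rcases Finset.mem_insert.1 hv with rfl | hv
      · right
        refine le_antisymm ?_ (hne v v).card_pos
        simpa using Finset.card_le_card (probe_self_subset R D v (a v))
      · exact Or.inl (h4 v hv)
  obtain ⟨H, h1, h2, h3, h4⟩ := main Finset.univ
  choose α hα using h3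
  refine ⟨α, fun v => h1 v (hα v), fun i j => ?_⟩
  obtain ⟨c, hc, hR⟩ := h2 i j _ (hα j)
  rwa [← Finset.card_le_one.1 (h4 i (Finset.mem_univ i)).le _ hc _ (hα i)]

theorem card_le_two_of_numFull_eq_zero {D : Table n} (h : numFull D = 0) (v : Fin n) :
    (D v).card ≤ 2 := by
  have hv : D v ≠ Finset.univ := by
    intro hv
    have := Finset.card_eq_zero.1 h
    have hm : v ∈ (Finset.univ.filter fun v => D v = Finset.univ) := by simp [hv]
    rw [this] at hm
    simp at hm
  have := (Finset.card_lt_iff_ne_univ (D v)).2 hv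
  simp at this
  omega

/-- Branching preserves solvability: a solution either uses a shrinking label, and then survives in
that branch, or it survives the pruning. -/
theorem solvable_iff {R : Rel n} (hsymm : ∀ i j a b, R i j a b = R j i b a) (D : Table n) :
    Solvable R D ↔ Accepts R D ∨ ∃ C ∈ children R D, Solvable R C := by
  constructor
  · rintro ⟨α, hα⟩
    by_cases hs : ∃ u, Shrinks R D u (α u)
    · obtain ⟨u, hu⟩ := hs
      exact Or.inr ⟨_, List.mem_append_right _ (List.mem_reverse.2 (mem_branches.2
        ⟨u, α u, (hα.probe u).not_hasEmpty, hu, rfl⟩)), α, hα.probe u⟩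
    · push Not at hs
      have hp : ∀ u, α u ∈ prune R D u := fun u =>
        Finset.mem_filter.2 ⟨hα.1 u, not_or.2 ⟨(hα.probe u).not_hasEmpty, hs u⟩⟩
      by_cases h0 : numFull D = 0
      · exact Or.inl ⟨h0, fun u => ⟨_, hp u⟩⟩
      · exact Or.inr ⟨prune R D, by simp [children, h0], α, hp, hα.2⟩
  · rintro (⟨h0, h⟩ | ⟨C, hC, α, hα⟩)
    · refine solvable_of_probes hsymm (card_le_two_of_numFull_eq_zero h0) fun u => ?_
      obtain ⟨a, ha⟩ := h u
      exact ⟨a, (not_or.1 (Finset.mem_filter.1 ha).2).1⟩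
    · rcases List.mem_append.1 hC with hC | hC
      · split_ifs at hC
        · simp at hC
        · rw [List.mem_singleton.1 hC] at hα
          exact ⟨α, hα.mono (prune_le R D)⟩
      · obtain ⟨u, a, -, -, rfl⟩ := mem_branches.1 (List.mem_reverse.1 hC)
        exact ⟨α, hα.mono (probe_le R D u a)⟩

/-! ### The size of the search tree -/

/-- In a complete instance each undecided variable has a contradictory or a shrinking label: every
other undecided variable is settled by one of the three labels. -/
theorem numFull_prune {R : Rel n} (hcomp : ∀ i j, i ≠ j → ∃ a b, R i j a b = false)
    (D : Table n) : numFull (prune R D) = 0 := by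
  classical
  unfold numFull
  rw [Finset.card_eq_zero, Finset.filter_eq_empty_iff]
  intro u _ hu
  have hDu : D u = Finset.univ := Finset.univ_subset_iff.1 (hu ▸ prune_le R D u)
  have hno : ∀ a, ¬ Shrinks R D u a := by
    intro a
    have : a ∈ prune R D u := hu ▸ Finset.mem_univ a
    exact (not_or.1 (Finset.mem_filter.1 this).2).2
  set F : Table n → Finset (Fin n) := fun X => Finset.univ.filter fun v => X v = Finset.univ
    with hF
  have hmem : ∀ X v, v ∈ F X ↔ X v = Finset.univ := fun X v => by simp [hF]
  have hcard : ∀ X, numFull X = (F X).card := fun X => rfl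
  -- a forbidden pair `u ↦ a`, `v ↦ b` excludes `b` from the domain of `v` once `u` has label `a`
  have hcover : (F D).erase u ⊆
      Finset.univ.biUnion fun a : Fin 3 => ((F D).erase u) \ F (probe R D u a) := by
    intro v hv
    obtain ⟨hvu, -⟩ := Finset.mem_erase.1 hv
    obtain ⟨a, b, hab⟩ := hcomp u v (Ne.symm hvu)
    refine Finset.mem_biUnion.2 ⟨a, Finset.mem_univ a, Finset.mem_sdiff.2 ⟨hv, fun hvF => ?_⟩⟩
    rw [hmem] at hvF
    obtain ⟨a', ha', hR⟩ := arcConsistent_arcClosure R (assign D u a) u v b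
      (by change b ∈ probe R D u a v; rw [hvF]; exact Finset.mem_univ b)
    rw [Finset.mem_singleton.1 (probe_self_subset R D u a ha')] at hR
    simp [hab] at hR
  have h1 := (Finset.card_le_card hcover).trans Finset.card_biUnion_le
  have huF : u ∈ F D := (hmem D u).2 hDu
  have h2 : ∀ a, (((F D).erase u) \ F (probe R D u a)).card + numFull (probe R D u a)
      = numFull D - 1 := by
    intro a
    have hsub : F (probe R D u a) ⊆ (F D).erase u := by
      intro v hv
      rw [hmem] at hv
      refine Finset.mem_erase.2 ⟨?_, (hmem D v).2
        (Finset.univ_subset_iff.1 (hv ▸ probe_le R D u a v))⟩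
      rintro rfl
      have := Finset.card_le_card (probe_self_subset R D v a)
      rw [hv] at this
      simp at this
    rw [hcard, hcard, Finset.card_sdiff_add_card_eq_card hsub, Finset.card_erase_of_mem huF]
  rw [Finset.card_erase_of_mem huF, Fin.sum_univ_three, ← hcard] at h1
  -- with `m` undecided variables, the three probes would settle at most `3 (m - 1) - 2 m < m - 1`
  have hpos : 0 < numFull D := Finset.card_pos.2 ⟨u, huF⟩
  have e0 := h2 0
  have e1 := h2 1
  have e2 := h2 2
  have n0 := hno 0
  have n1 := hno 1
  have n2 := hno 2
  unfold Shrinks at n0 n1 n2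
  omega

/-- A bound for the number of tables in the search tree below `X`. The exponent grows by at least
one when the number of undecided variables grows by more than a factor of `3 / 2 > √2`. -/
def weight (X : Table n) : ℕ := (3 * n + 2) ^ Nat.log 2 (2 * numFull X ^ 2)

theorem log_lt_of_shrink {m k : ℕ} (h : 3 * m < 2 * k) :
    Nat.log 2 (2 * m ^ 2) + 1 ≤ Nat.log 2 (2 * k ^ 2) := by
  have hk : 1 ≤ k := by omega
  rcases Nat.eq_zero_or_pos m with rfl | hm
  · have h2 : 2 ≤ 2 * k ^ 2 := by nlinarith
    have := Nat.log_pos (b := 2) one_lt_two h2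
    simp only [ne_eq, OfNat.ofNat_ne_zero, not_false_eq_true, zero_pow, mul_zero,
      Nat.log_zero_right]
    omega
  · rw [← Nat.log_mul_base (by norm_num) (by positivity)]
    apply Nat.log_mono_right
    nlinarith

theorem sum_map_flatMap_le {α β : Type*} (l : List α) (f : α → List β) (g : β → ℕ) (c : ℕ)
    (h : ∀ a ∈ l, ((f a).map g).sum ≤ c) : ((l.flatMap f).map g).sum ≤ l.length * c := by
  induction l with
  | nil => simp
  | cons a l ih =>
    simp only [List.flatMap_cons, List.map_append, List.sum_append, List.length_cons]
    have := h a (by simp)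
    have := ih fun b hb => h b (by simp [hb])
    linarith

/-- The weight of a table pays for the table itself and for all its subproblems. -/
theorem sum_weight_children {R : Rel n} (hcomp : ∀ i j, i ≠ j → ∃ a b, R i j a b = false)
    (D : Table n) : 1 + ((children R D).map weight).sum ≤ weight D := by
  classical
  by_cases h0 : numFull D = 0
  · have hb : branches R D = [] := by
      refine List.eq_nil_iff_forall_not_mem.2 fun C hC => ?_
      obtain ⟨u, a, -, hs, -⟩ := mem_branches.1 hC
      unfold Shrinks at hs
      omega
    simp [children, h0, hb, weight]
  · obtain ⟨e, he⟩ : ∃ e, Nat.log 2 (2 * numFull D ^ 2) = e + 1 := by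
      have := log_lt_of_shrink (m := 0) (k := numFull D) (by omega)
      exact ⟨Nat.log 2 (2 * numFull D ^ 2) - 1, by omega⟩
    have hb : ((branches R D).map weight).sum ≤ n * (3 * (3 * n + 2) ^ e) := by
      have hu : ∀ u ∈ List.finRange n, (((List.finRange 3).flatMap fun a =>
          branch R D u a).map weight).sum ≤ 3 * (3 * n + 2) ^ e := by
        intro u _
        refine (sum_map_flatMap_le _ _ _ ((3 * n + 2) ^ e) fun a _ => ?_).trans (by simp)
        unfold branch
        split_ifs with h
        · simp only [List.map_cons, List.map_nil, List.sum_cons, List.sum_nil, add_zero]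
          apply Nat.pow_le_pow_right (by omega)
          have := log_lt_of_shrink h.2
          omega
        · simp
      exact (sum_map_flatMap_le _ _ _ _ hu).trans (by simp)
    have hp : weight (prune R D) = 1 := by simp [weight, numFull_prune hcomp]
    have hone : 1 ≤ (3 * n + 2) ^ e := Nat.one_le_pow _ _ (by omega)
    simp only [children, h0, if_false, List.map_append, List.map_reverse, List.sum_reverse,
      List.sum_append, List.map_cons,
      List.map_nil, List.sum_cons, List.sum_nil, hp]
    rw [weight, he, pow_succ]
    nlinarith

/-! ### Structured programs for multi-stack machines -/

section Language

open Turing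

variable {K : Type} [DecidableEq K] {Γ : K → Type} {σ : Type}

/-- Structured programs over the stacks `Γ` with a register of type `σ`. As in `TM2`, `pop` passes
`none` to the register if the stack is empty. -/
inductive Cmd (Γ : K → Type) (σ : Type) : Type
  | push (k : K) (f : σ → Γ k) : Cmd Γ σ
  | pop (k : K) (f : σ → Option (Γ k) → σ) : Cmd Γ σ
  | load (f : σ → σ) : Cmd Γ σ
  | seq (c d : Cmd Γ σ) : Cmd Γ σ
  | ite (p : σ → Bool) (c d : Cmd Γ σ) : Cmd Γ σ
  | loop (p : σ → Bool) (c : Cmd Γ σ) : Cmd Γ σ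

/-- Sequential composition. -/
infixr:60 " ;; " => Cmd.seq

/-- The program positions of a command, which serve as machine labels. -/
def Pos : Cmd Γ σ → Type
  | .push _ _ => Unit
  | .pop _ _ => Unit
  | .load _ => Unit
  | .seq c d => Pos c ⊕ Pos d
  | .ite _ c d => Option (Pos c ⊕ Pos d)
  | .loop _ c => Option (Pos c)

/-- The position at which the execution of a command starts. -/
def entry : (c : Cmd Γ σ) → Pos c
  | .push _ _ => ()
  | .pop _ _ => ()
  | .load _ => ()
  | .seq c _ => Sum.inl (entry c)
  | .ite _ _ _ => none
  | .loop _ _ => none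

noncomputable instance posFintype : (c : Cmd Γ σ) → Fintype (Pos c)
  | .push _ _ => inferInstanceAs (Fintype Unit)
  | .pop _ _ => inferInstanceAs (Fintype Unit)
  | .load _ => inferInstanceAs (Fintype Unit)
  | .seq c d =>
    haveI := posFintype c
    haveI := posFintype d
    inferInstanceAs (Fintype (Pos c ⊕ Pos d))
  | .ite _ c d =>
    haveI := posFintype c
    haveI := posFintype d
    inferInstanceAs (Fintype (Option (Pos c ⊕ Pos d)))
  | .loop _ c =>
    haveI := posFintype c
    inferInstanceAs (Fintype (Option (Pos c)))

/-- The machine code of a command, whose positions are embedded by `e` into the labels of a larger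
machine and which continues with the statement `q`. -/
def code {Λ : Type} : (c : Cmd Γ σ) → (Pos c → Λ) → TM2.Stmt Γ Λ σ → Pos c → TM2.Stmt Γ Λ σ
  | .push k f, _, q, _ => .push k f q
  | .pop k f, _, q, _ => .pop k f q
  | .load f, _, q, _ => .load f q
  | .seq c d, e, _, Sum.inl x =>
    code c (fun y => e (Sum.inl y)) (.goto fun _ => e (Sum.inr (entry d))) x
  | .seq _ d, e, q, Sum.inr x => code d (fun y => e (Sum.inr y)) q x
  | .ite p c d, e, _, none =>
    .branch p (.goto fun _ => e (some (Sum.inl (entry c))))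
      (.goto fun _ => e (some (Sum.inr (entry d))))
  | .ite _ c _, e, q, some (Sum.inl x) => code c (fun y => e (some (Sum.inl y))) q x
  | .ite _ _ d, e, q, some (Sum.inr x) => code d (fun y => e (some (Sum.inr y))) q x
  | .loop p c, e, q, none => .branch p (.goto fun _ => e (some (entry c))) q
  | .loop _ c, e, _, some x => code c (fun y => e (some y)) (.goto fun _ => e none) x

/-- The semantics of commands, stated on machines: every machine that contains the code of `c` gets,
within `t` steps, from the start of that code with memory `s` to its continuation with memory
`s'`. -/
def RunsOn (c : Cmd Γ σ) (s s' : σ × ∀ k, List (Γ k)) (t : ℕ) : Prop :=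
  ∀ (Λ : Type) (M : Λ → TM2.Stmt Γ Λ σ) (e : Pos c → Λ) (q : TM2.Stmt Γ Λ σ),
    (∀ x, M (e x) = code c e q x) →
    ∃ t' ≤ t, (flip bind (TM2.step M))^[t'] (some ⟨some (e (entry c)), s.1, s.2⟩) =
      some (TM2.stepAux q s'.1 s'.2)

theorem RunsOn.mono {c : Cmd Γ σ} {s s' : σ × ∀ k, List (Γ k)} {t u : ℕ} (h : RunsOn c s s' t)
    (htu : t ≤ u) : RunsOn c s s' u := fun Λ M e q hM => by
  obtain ⟨t', ht', h'⟩ := h Λ M e q hM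
  exact ⟨t', ht'.trans htu, h'⟩

theorem bind_step {Λ : Type} (M : Λ → TM2.Stmt Γ Λ σ) (l : Λ) (v : σ) (S : ∀ k, List (Γ k)) :
    flip bind (TM2.step M) (some ⟨some l, v, S⟩) = some (TM2.stepAux (M l) v S) := rfl

theorem runsOn_push (k : K) (f : σ → Γ k) (v : σ) (S : ∀ k, List (Γ k)) :
    RunsOn (.push k f) (v, S) (v, Function.update S k (f v :: S k)) 1 := fun Λ M e q hM => by
  refine ⟨1, le_rfl, ?_⟩
  rw [Function.iterate_one, bind_step, hM]
  rfl

theorem runsOn_pop (k : K) (f : σ → Option (Γ k) → σ) (v : σ) (S : ∀ k, List (Γ k)) :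
    RunsOn (.pop k f) (v, S) (f v (S k).head?, Function.update S k (S k).tail) 1 :=
  fun Λ M e q hM => by
  refine ⟨1, le_rfl, ?_⟩
  rw [Function.iterate_one, bind_step, hM]
  rfl

theorem runsOn_load (f : σ → σ) (v : σ) (S : ∀ k, List (Γ k)) :
    RunsOn (.load f) (v, S) (f v, S) 1 := fun Λ M e q hM => by
  refine ⟨1, le_rfl, ?_⟩
  rw [Function.iterate_one, bind_step, hM]
  rfl

theorem RunsOn.seq {c d : Cmd Γ σ} {s s' s'' : σ × ∀ k, List (Γ k)} {t u : ℕ}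
    (hc : RunsOn c s s' t) (hd : RunsOn d s' s'' u) : RunsOn (c ;; d) s s'' (t + u) :=
  fun Λ M e q hM => by
  obtain ⟨t', ht', h1⟩ := hc Λ M (fun y => e (Sum.inl y)) (.goto fun _ => e (Sum.inr (entry d)))
    fun x => hM (Sum.inl x)
  obtain ⟨u', hu', h2⟩ := hd Λ M (fun y => e (Sum.inr y)) q fun x => hM (Sum.inr x)
  refine ⟨u' + t', by omega, ?_⟩
  rw [Function.iterate_add_apply]
  exact (congrArg _ h1).trans h2

theorem RunsOn.ite_true {p : σ → Bool} {c d : Cmd Γ σ} {s s' : σ × ∀ k, List (Γ k)} {t : ℕ}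
    (hp : p s.1 = true) (hc : RunsOn c s s' t) : RunsOn (.ite p c d) s s' (t + 1) :=
  fun Λ M e q hM => by
  obtain ⟨t', ht', h1⟩ := hc Λ M (fun y => e (some (Sum.inl y))) q fun x => hM (some (Sum.inl x))
  refine ⟨t' + 1, by omega, ?_⟩
  rw [Function.iterate_succ_apply]
  refine (congrArg _ ?_).trans h1
  rw [bind_step, hM]
  simp [entry, code, TM2.stepAux, hp]

theorem RunsOn.ite_false {p : σ → Bool} {c d : Cmd Γ σ} {s s' : σ × ∀ k, List (Γ k)} {t : ℕ}
    (hp : p s.1 = false) (hd : RunsOn d s s' t) : RunsOn (.ite p c d) s s' (t + 1) :=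
  fun Λ M e q hM => by
  obtain ⟨t', ht', h1⟩ := hd Λ M (fun y => e (some (Sum.inr y))) q fun x => hM (some (Sum.inr x))
  refine ⟨t' + 1, by omega, ?_⟩
  rw [Function.iterate_succ_apply]
  refine (congrArg _ ?_).trans h1
  rw [bind_step, hM]
  simp [entry, code, TM2.stepAux, hp]

theorem RunsOn.loop_false {p : σ → Bool} {c : Cmd Γ σ} {s : σ × ∀ k, List (Γ k)}
    (hp : p s.1 = false) : RunsOn (.loop p c) s s 1 := fun Λ M e q hM => by
  refine ⟨1, le_rfl, ?_⟩
  rw [Function.iterate_one, bind_step, hM]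
  simp [entry, code, TM2.stepAux, hp]

theorem RunsOn.loop_true {p : σ → Bool} {c : Cmd Γ σ} {s s' s'' : σ × ∀ k, List (Γ k)} {t u : ℕ}
    (hp : p s.1 = true) (hc : RunsOn c s s' t) (hl : RunsOn (.loop p c) s' s'' u) :
    RunsOn (.loop p c) s s'' (t + u + 1) := fun Λ M e q hM => by
  obtain ⟨t', ht', h1⟩ := hc Λ M (fun y => e (some y)) (.goto fun _ => e none)
    fun x => hM (some x)
  obtain ⟨u', hu', h2⟩ := hl Λ M e q hM
  refine ⟨u' + t' + 1, by omega, ?_⟩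
  rw [Function.iterate_succ_apply, Function.iterate_add_apply]
  refine (congrArg _ ?_).trans h2
  refine (congrArg _ ?_).trans h1
  rw [bind_step, hM]
  simp [entry, code, TM2.stepAux, hp]

/-- The machine whose labels are the positions of `c`, and which halts after `c`. -/
@[reducible] noncomputable def machine [Fintype K] (k₀ k₁ : K) [Fintype (Γ k₀)] [Fintype σ] (v₀ : σ)
    (c : Cmd Γ σ) : FinTM2 where
  K := K
  k₀ := k₀
  k₁ := k₁
  Γ := Γ
  Λ := Pos c
  main := entry c
  σ := σ
  initialState := v₀
  m := code c id .halt

/-- A command that turns the initial memory into the final one computes the corresponding output. -/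
theorem machine_outputs [Fintype K] (k₀ k₁ : K) [Fintype (Γ k₀)] [Fintype σ] (v₀ : σ)
    (c : Cmd Γ σ) (x : List (Γ k₀)) (y : List (Γ k₁)) (t : ℕ)
    (h : RunsOn c (v₀, Function.update (fun _ => []) k₀ x)
      (v₀, Function.update (fun _ => []) k₁ y) t) :
    Nonempty (TM2OutputsInTime (machine k₀ k₁ v₀ c) x (some y) t) := by
  have hupd : ∀ (k₂ : K) (z : List (Γ k₂)), (fun k => @dite (List (Γ k)) (k = k₂) _
      (fun h => by rw [h]; exact z) fun _ => []) = Function.update (fun _ => []) k₂ z := by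
    intro k₂ z
    funext k
    by_cases hk : k = k₂
    · subst hk; simp
    · simp [hk]
  obtain ⟨t', ht', h1⟩ := h (Pos c) (code c id .halt) id .halt fun _ => rfl
  refine ⟨⟨⟨t', ?_⟩, ht'⟩⟩
  rw [← hupd, ← hupd] at h1
  exact h1

end Language

/-! ### The memory of the machine and passes over the table -/

/-- One variable's entry of the table on the machine: the current domain `d`, the pruned domain `e`,
the domain `x` being probed, and marks that point to the variables that three nested loops are
looking at. -/
structure Rec where
  d : Dom
  e : Dom
  x : Dom
  m : Fin 3 → Bool

noncomputable instance : Fintype Rec :=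
  Fintype.ofInjective (fun r => (r.d, r.e, r.x, r.m)) fun ⟨_, _, _, _⟩ ⟨_, _, _, _⟩ h => by
    simpa using h

instance : Inhabited Rec := ⟨⟨∅, ∅, ∅, fun _ => false⟩⟩

/-- The five stacks: the input word, a stack for the part of the input already read (also used as a
counter and for the output), the table, the part of the table already visited, and the work list. -/
inductive Stack
  | inp | out | tab | aux | work
deriving DecidableEq

instance : Fintype Stack := ⟨{.inp, .out, .tab, .aux, .work}, fun k => by cases k <;> decide⟩

/-- The work list consists of domains: a table is put on it one variable at a time. -/
@[reducible] def Alphabet : Stack → Type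
  | .inp => Bool
  | .out => Bool
  | .tab => Rec
  | .aux => Rec
  | .work => Dom

/-- The finite register: the last symbols taken from the stacks (`cur`, `bit`, `nxt`), the domain
`lbl` of the variable with respect to which others are revised, the labels `sup` found to be
supported, and some flags. -/
structure Reg where
  cur : Option Rec
  lbl : Dom
  sup : Dom
  bit : Option Bool
  nxt : Option Dom
  carry : Bool
  emp : Bool
  small : Bool
  ans : Bool

noncomputable instance : Fintype Reg :=
  Fintype.ofInjective
    (fun g => (g.cur, g.lbl, g.sup, g.bit, g.nxt, g.carry, g.emp, g.small, g.ans))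
    fun ⟨_, _, _, _, _, _, _, _, _⟩ ⟨_, _, _, _, _, _, _, _, _⟩ h => by simpa using h

/-- The initial and final value of the register. -/
def Reg.init : Reg := ⟨none, ∅, ∅, none, none, false, false, false, false⟩

/-- The memory of the machine: the register and the contents of the stacks. -/
structure Mem where
  g : Reg
  inp : List Bool
  out : List Bool
  tab : List Rec
  aux : List Rec
  work : List Dom

/-- The stacks in the form in which `TM2` has them. -/
def Mem.stk (s : Mem) : ∀ k, List (Alphabet k)
  | .inp => s.inp
  | .out => s.out
  | .tab => s.tab
  | .aux => s.aux
  | .work => s.work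

/-- Programs for this memory. -/
abbrev Prog := Cmd Alphabet Reg

/-- The program `c` turns the memory `s` into `s'` within `t` steps. -/
def Runs (c : Prog) (s s' : Mem) (t : ℕ) : Prop := RunsOn c (s.g, s.stk) (s'.g, s'.stk) t

theorem Runs.mono {c : Prog} {s s' s'' : Mem} {t u : ℕ} (h : Runs c s s'' t) (hs : s'' = s')
    (htu : t ≤ u) : Runs c s s' u := by
  subst hs
  exact RunsOn.mono h htu

theorem Runs.seq {c d : Prog} {s s' s'' : Mem} {t u : ℕ} (hc : Runs c s s' t)
    (hd : Runs d s' s'' u) : Runs (c ;; d) s s'' (t + u) := RunsOn.seq hc hd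

theorem Runs.ite {p : Reg → Bool} {c d : Prog} {s s' : Mem} {t : ℕ}
    (hc : p s.g = true → Runs c s s' t) (hd : p s.g = false → Runs d s s' t) :
    Runs (.ite p c d) s s' (t + 1) := by
  cases h : p s.g
  · exact RunsOn.ite_false h (hd h)
  · exact RunsOn.ite_true h (hc h)

theorem runs_load (f : Reg → Reg) (s : Mem) : Runs (.load f) s { s with g := f s.g } 1 :=
  runsOn_load f s.g s.stk

theorem Mem.update_eq (s s' : Mem) (k : Stack) (l : List (Alphabet k)) (hk : s'.stk k = l)
    (h : ∀ j, j ≠ k → s'.stk j = s.stk j) : Function.update s.stk k l = s'.stk := by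
  funext j
  by_cases hj : j = k
  · subst hj; simp [hk]
  · simp [hj, h j hj]

theorem runs_push (k : Stack) (f : Reg → Alphabet k) (s s' : Mem) (hg : s'.g = s.g)
    (hk : s'.stk k = f s.g :: s.stk k) (h : ∀ j, j ≠ k → s'.stk j = s.stk j) :
    Runs (.push k f) s s' 1 := by
  have h1 := runsOn_push k f s.g s.stk
  rw [s.update_eq s' k _ hk h] at h1
  unfold Runs
  rw [hg]
  exact h1

theorem runs_pop (k : Stack) (f : Reg → Option (Alphabet k) → Reg) (s s' : Mem)
    (hg : s'.g = f s.g (s.stk k).head?) (hk : s'.stk k = (s.stk k).tail)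
    (h : ∀ j, j ≠ k → s'.stk j = s.stk j) : Runs (.pop k f) s s' 1 := by
  have h1 := runsOn_pop k f s.g s.stk
  rw [s.update_eq s' k _ hk h] at h1
  unfold Runs
  rw [hg]
  exact h1

theorem runs_push_inp (f : Reg → Bool) (s : Mem) :
    Runs (.push .inp f) s { s with inp := f s.g :: s.inp } 1 :=
  runs_push .inp f _ _ rfl rfl (by rintro (_ | _) <;> simp [Mem.stk])

theorem runs_push_out (f : Reg → Bool) (s : Mem) :
    Runs (.push .out f) s { s with out := f s.g :: s.out } 1 :=
  runs_push .out f _ _ rfl rfl (by rintro (_ | _) <;> simp [Mem.stk])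

theorem runs_push_tab (f : Reg → Rec) (s : Mem) :
    Runs (.push .tab f) s { s with tab := f s.g :: s.tab } 1 :=
  runs_push .tab f _ _ rfl rfl (by rintro (_ | _) <;> simp [Mem.stk])

theorem runs_push_aux (f : Reg → Rec) (s : Mem) :
    Runs (.push .aux f) s { s with aux := f s.g :: s.aux } 1 :=
  runs_push .aux f _ _ rfl rfl (by rintro (_ | _) <;> simp [Mem.stk])

theorem runs_push_work (f : Reg → Dom) (s : Mem) :
    Runs (.push .work f) s { s with work := f s.g :: s.work } 1 :=
  runs_push .work f _ _ rfl rfl (by rintro (_ | _) <;> simp [Mem.stk])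

theorem runs_pop_inp (f : Reg → Option Bool → Reg) (s : Mem) :
    Runs (.pop .inp f) s { s with g := f s.g s.inp.head?, inp := s.inp.tail } 1 :=
  runs_pop .inp f _ _ rfl rfl (by rintro (_ | _) <;> simp [Mem.stk])

theorem runs_pop_out (f : Reg → Option Bool → Reg) (s : Mem) :
    Runs (.pop .out f) s { s with g := f s.g s.out.head?, out := s.out.tail } 1 :=
  runs_pop .out f _ _ rfl rfl (by rintro (_ | _) <;> simp [Mem.stk])

theorem runs_pop_tab (f : Reg → Option Rec → Reg) (s : Mem) :
    Runs (.pop .tab f) s { s with g := f s.g s.tab.head?, tab := s.tab.tail } 1 :=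
  runs_pop .tab f _ _ rfl rfl (by rintro (_ | _) <;> simp [Mem.stk])

theorem runs_pop_aux (f : Reg → Option Rec → Reg) (s : Mem) :
    Runs (.pop .aux f) s { s with g := f s.g s.aux.head?, aux := s.aux.tail } 1 :=
  runs_pop .aux f _ _ rfl rfl (by rintro (_ | _) <;> simp [Mem.stk])

theorem runs_pop_work (f : Reg → Option Dom → Reg) (s : Mem) :
    Runs (.pop .work f) s { s with g := f s.g s.work.head?, work := s.work.tail } 1 :=
  runs_pop .work f _ _ rfl rfl (by rintro (_ | _) <;> simp [Mem.stk])

/-- The memories `S k` at the successive evaluations of the condition describe a run of a loop. -/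
theorem runs_loop {p : Reg → Bool} {c : Prog} (S : ℕ → Mem) (N τ : ℕ)
    (hp : ∀ k < N, p (S k).g = true) (hc : ∀ k < N, Runs c (S k) (S (k + 1)) τ)
    (hN : p (S N).g = false) : Runs (.loop p c) (S 0) (S N) (N * (τ + 1) + 1) := by
  induction N generalizing S with
  | zero => exact RunsOn.mono (RunsOn.loop_false hN) (by omega)
  | succ N ih =>
    have h := ih (fun k => S (k + 1)) (fun k hk => hp (k + 1) (by omega))
      (fun k hk => hc (k + 1) (by omega)) hN
    exact RunsOn.mono (RunsOn.loop_true (hp 0 (by omega)) (hc 0 (by omega)) h)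
      (by rw [Nat.succ_mul]; omega)

/-- The memory `s` with the current entry `c` and the table split into `t` and `r`. -/
def Mem.at (s : Mem) (c : Option Rec) (t r : List Rec) : Mem :=
  { s with g := { s.g with cur := c }, tab := t, aux := r }

/-- Visit the entries of the table in order, run `b` on each and move it to the other stack. -/
def forth (b : Prog) : Prog :=
  .pop .tab (fun g c => { g with cur := c }) ;;
  .loop (fun g => g.cur.isSome)
    (b ;; .push .aux (fun g => g.cur.getD default) ;; .pop .tab (fun g c => { g with cur := c }))

/-- Visit the entries in reverse order, and move them back. -/
def back (b : Prog) : Prog :=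
  .pop .aux (fun g c => { g with cur := c }) ;;
  .loop (fun g => g.cur.isSome)
    (b ;; .push .tab (fun g => g.cur.getD default) ;; .pop .aux (fun g c => { g with cur := c }))

/-- Do nothing. -/
def skip : Prog := .load id

/-- Run `b` on each entry of the table in order, and restore the position of the table. -/
def pass (b : Prog) : Prog := forth b ;; back skip

/-- The memory apart from the table is `z k` after `k` entries, and `b` turns the `k`-th entry from
`l[k]` into `l'[k]`. -/
theorem runs_forth {b : Prog} {τ : ℕ} (z : ℕ → Mem) (l l' : List Rec) (hl : l.length = l'.length)
    (hb : ∀ (k : ℕ) (h : k < l.length) (t r : List Rec), Runs b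
      ((z k).at (some l[k]) t r) ((z (k + 1)).at (some (l'[k]'(hl ▸ h))) t r) τ) (r : List Rec) :
    Runs (forth b) ((z 0).at none l r) ((z l.length).at none [] (l'.reverse ++ r))
      (l.length * (τ + 3) + 2) := by
  have h := runs_loop (p := fun g : Reg => g.cur.isSome)
    (c := b ;; .push .aux (fun g => g.cur.getD default) ;;
      .pop .tab (fun g c => { g with cur := c }))
    (fun k => (z k).at l[k]? (l.drop (k + 1)) ((l'.take k).reverse ++ r)) l.length (τ + 2)
    (fun k hk => by simp [Mem.at, hk])
    (fun k hk => by
      refine ((by simpa only [List.getElem?_eq_getElem hk] using hb k hk _ _ :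
        Runs b _ _ τ).seq ((runs_push_aux _ _).seq (runs_pop_tab _ _))).mono ?_ le_rfl
      have hk' : k < l'.length := hl ▸ hk
      simp only [Mem.at, Option.getD_some, List.head?_drop, List.tail_drop,
        List.take_succ_eq_append_getElem hk', List.reverse_append, List.reverse_singleton,
        List.nil_append, List.cons_append])
    (by simp [Mem.at])
  refine (((runs_pop_tab _ _).mono ?_ le_rfl).seq h).mono ?_ (Nat.le_of_eq (by ring))
  · cases l <;> rfl
  · rw [List.drop_eq_nil_of_le (Nat.le_succ _), List.take_of_length_le hl.ge,
      List.getElem?_eq_none le_rfl]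

/-- The counterpart of `runs_forth`; here `l` lists the entries in the order in which they are
visited, from the last variable to the first. -/
theorem runs_back {b : Prog} {τ : ℕ} (z : ℕ → Mem) (l l' : List Rec) (hl : l.length = l'.length)
    (hb : ∀ (k : ℕ) (h : k < l.length) (t r : List Rec), Runs b
      ((z k).at (some l[k]) t r) ((z (k + 1)).at (some (l'[k]'(hl ▸ h))) t r) τ) (t : List Rec) :
    Runs (back b) ((z 0).at none t l) ((z l.length).at none (l'.reverse ++ t) [])
      (l.length * (τ + 3) + 2) := by
  have h := runs_loop (p := fun g : Reg => g.cur.isSome)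
    (c := b ;; .push .tab (fun g => g.cur.getD default) ;;
      .pop .aux (fun g c => { g with cur := c }))
    (fun k => (z k).at l[k]? ((l'.take k).reverse ++ t) (l.drop (k + 1))) l.length (τ + 2)
    (fun k hk => by simp [Mem.at, hk])
    (fun k hk => by
      refine ((by simpa only [List.getElem?_eq_getElem hk] using hb k hk _ _ :
        Runs b _ _ τ).seq ((runs_push_tab _ _).seq (runs_pop_aux _ _))).mono ?_ le_rfl
      have hk' : k < l'.length := hl ▸ hk
      simp only [Mem.at, Option.getD_some, List.head?_drop, List.tail_drop,
        List.take_succ_eq_append_getElem hk', List.reverse_append, List.reverse_singleton,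
        List.nil_append, List.cons_append])
    (by simp [Mem.at])
  refine (((runs_pop_aux _ _).mono ?_ le_rfl).seq h).mono ?_ (Nat.le_of_eq (by ring))
  · cases l <;> rfl
  · rw [List.drop_eq_nil_of_le (Nat.le_succ _), List.take_of_length_le hl.ge,
      List.getElem?_eq_none le_rfl]

theorem runs_pass {n : ℕ} {b : Prog} {τ : ℕ} (z : ℕ → Mem) (T T' : Fin n → Rec)
    (hb : ∀ (k : ℕ) (h : k < n) (t r : List Rec), Runs b
      ((z k).at (some (T ⟨k, h⟩)) t r) ((z (k + 1)).at (some (T' ⟨k, h⟩)) t r) τ) :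
    Runs (pass b) ((z 0).at none (List.ofFn T) []) ((z n).at none (List.ofFn T') [])
      (n * (τ + 7) + 4) := by
  have h1 := runs_forth z (List.ofFn T) (List.ofFn T') (by simp)
    (fun k h t r => by simpa using hb k (by simpa using h) t r) []
  have h2 := runs_back (b := skip) (fun _ => z n) (List.ofFn T').reverse (List.ofFn T').reverse rfl
    (fun k h t r => runs_load id _) []
  simp only [List.length_ofFn, List.append_nil, List.length_reverse, List.reverse_reverse] at h1 h2
  exact (h1.seq h2).mono rfl (Nat.le_of_eq (by ring))

/-! ### Loops over the variables -/

/-- The state of the algorithm between two passes over the table. The position `p k` of the `k`-th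
mark is one more than the index of the marked variable, and there is no marked variable if it is
`0` or `n + 1`. -/
structure Config (n : ℕ) where
  inp : List Bool
  out : List Bool
  D : Table n
  E : Table n
  X : Table n
  p : Fin 3 → ℕ
  W : List Dom
  lbl : Dom
  emp : Bool
  small : Bool
  ans : Bool

/-- The entry of the table for the variable `v`. -/
def Config.recs (L : Config n) (v : Fin n) : Rec :=
  ⟨L.D v, L.E v, L.X v, fun k => decide ((v : ℕ) + 1 = L.p k)⟩

/-- The memory apart from the table. -/
def Config.base (L : Config n) : Mem where
  g := { Reg.init with lbl := L.lbl, emp := L.emp, small := L.small, ans := L.ans }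
  inp := L.inp
  out := L.out
  tab := []
  aux := []
  work := L.W

/-- The memory that represents a configuration. -/
def Config.toMem (L : Config n) : Mem := L.base.at none (List.ofFn L.recs) []

/-- A pass that leads from `L` to `L'`: the memory apart from the table is `z k` after `k` entries,
and each entry changes from its state in `L` to its state in `L'`. -/
theorem runs_pass_config {b : Prog} {τ : ℕ} (z : ℕ → Mem) (L L' : Config n) (h0 : z 0 = L.base)
    (hn : z n = L'.base) (hb : ∀ (k : ℕ) (h : k < n) (t r : List Rec), Runs b
      ((z k).at (some (L.recs ⟨k, h⟩)) t r) ((z (k + 1)).at (some (L'.recs ⟨k, h⟩)) t r) τ) :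
    Runs (pass b) L.toMem L'.toMem (n * (τ + 7) + 4) := by
  have := runs_pass z _ _ hb
  rwa [h0, hn] at this

/-- Change the current entry. -/
def onCur (f : Reg → Rec → Rec) : Prog := .load fun g => { g with cur := g.cur.map (f g) }

/-- A pass that changes each entry independently of the others. -/
theorem runs_pass_onCur (f : Reg → Rec → Rec) (L L' : Config n) (hbase : L'.base = L.base)
    (h : ∀ v, L'.recs v = f (L.base.at (some (L.recs v)) [] []).g (L.recs v)) :
    Runs (pass (onCur f)) L.toMem L'.toMem (n * 8 + 4) := by
  have := runs_pass (b := onCur f) (τ := 1) (fun _ => L.base) L.recs L'.recs fun k hk t r =>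
    (runs_load _ _).mono (by rw [h]; rfl) le_rfl
  unfold Config.toMem
  rw [hbase]
  exact this

/-- Move the `m`-th mark to the next variable; the bit `carry` is the mark of the previous entry. -/
def advance (m : Fin 3) : Prog :=
  pass (.load fun g => { g with
    cur := g.cur.map fun r => { r with m := Function.update r.m m g.carry }
    carry := (g.cur.map fun r => r.m m).getD false })

/-- Run `b` with the `m`-th mark on each variable in turn. -/
def forEach (m : Fin 3) (b : Prog) : Prog :=
  .load (fun g => { g with carry := true }) ;; advance m ;;
  .loop (fun g => !g.carry) (b ;; advance m) ;; .load (fun g => { g with carry := false })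

/-- The memory `s` with the bit `carry` set to `b`. -/
def Mem.withCarry (s : Mem) (b : Bool) : Mem := { s with g := { s.g with carry := b } }

/-- The configuration `L` with the `m`-th mark at position `j`. -/
def Config.mark (L : Config n) (m : Fin 3) (j : ℕ) : Config n :=
  { L with p := Function.update L.p m j }

/-- Position `0` stands for a mark just before the first variable, represented by the bit `carry`
at the start; at the end this bit tells whether the mark has left the table. -/
theorem runs_advance (m : Fin 3) (L : Config n) (j : ℕ) :
    Runs (advance m) ((L.mark m j).toMem.withCarry (decide (j = 0)))
      ((L.mark m (j + 1)).toMem.withCarry (decide (j = n))) (n * 8 + 4) := by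
  refine (runs_pass (τ := 1) (fun k => L.base.withCarry (decide (j = k))) (L.mark m j).recs
    (L.mark m (j + 1)).recs fun k hk t r => ?_).mono rfl le_rfl
  refine (runs_load _ _).mono ?_ le_rfl
  have e1 : decide (k + 1 = j) = decide (j = k + 1) := by simp [eq_comm]
  have e2 : (fun i => decide (k + 1 = Function.update L.p m (j + 1) i)) =
      Function.update (fun i => decide (k + 1 = Function.update L.p m j i)) m
        (decide (j = k)) := by
    funext i
    by_cases hi : i = m
    · subst hi; simp [eq_comm]
    · simp [hi]
  simp [Mem.at, Mem.withCarry, Config.recs, Config.base, Config.mark, e1]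
  exact e2.symm

theorem toMem_mark_last (L : Config n) (m : Fin 3) (h : L.p m = 0) :
    (L.mark m (n + 1)).toMem = L.toMem := by
  have : (L.mark m (n + 1)).recs = L.recs := by
    funext v
    have hv := v.2
    unfold Config.recs Config.mark
    congr 1
    funext k
    by_cases hk : k = m
    · subst hk
      simp [h]
      omega
    · simp [hk]
  unfold Config.toMem
  rw [this]
  rfl

/-- The configurations `L i` before the `i`-th iteration, with the `m`-th mark disregarded, describe
a run of a loop over the variables. -/
theorem runs_forEach (m : Fin 3) {b : Prog} {τ : ℕ} (L : ℕ → Config n)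
    (hp : ∀ i, (L i).p m = 0)
    (hb : ∀ i < n, Runs b ((L i).mark m (i + 1)).toMem ((L (i + 1)).mark m (i + 1)).toMem τ) :
    Runs (forEach m b) (L 0).toMem (L n).toMem (n * (τ + n * 8 + 5) + (n * 8 + 7)) := by
  have h0 := runs_advance m (L 0) 0
  have hl := runs_loop (p := fun g : Reg => !g.carry) (c := b ;; advance m)
    (fun i => ((L i).mark m (i + 1)).toMem.withCarry (decide (i = n))) n (τ + (n * 8 + 4))
    (fun i hi => by simp [Mem.withCarry]; omega)
    (fun i hi => by
      have h1 := hb i hi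
      have h2 := runs_advance m (L (i + 1)) (i + 1)
      rw [decide_eq_false (Nat.succ_ne_zero i)] at h2
      simp only [decide_eq_false (Nat.ne_of_lt hi)]
      exact h1.seq h2)
    (by simp [Mem.withCarry])
  have hz : (L 0).mark m 0 = L 0 := by
    have := Function.update_eq_self m (L 0).p
    rw [hp 0] at this
    unfold Config.mark
    rw [this]
  rw [hz] at h0
  have h1 := runs_load (fun g => { g with carry := true }) (L 0).toMem
  refine (h1.seq (Runs.seq h0 (hl.seq (runs_load _ _)))).mono ?_ (Nat.le_of_eq (by ring))
  rw [← toMem_mark_last (L n) m (hp n)]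
  rfl

/-! ### Arc consistency on the machine -/

/-- The truth table of a predicate as it appears in the input word. -/
def tableBits (f : Fin 3 → Fin 3 → Bool) : List Bool :=
  (List.finRange 3).flatMap fun a => (List.finRange 3).map fun b => f a b

/-- The row of the input matrix for the variable `i`. -/
def rowBits (R : Rel n) (i : Fin n) : List Bool :=
  (List.finRange n).flatMap fun j => tableBits (R i j)

/-- The input matrix. -/
def allBits (R : Rel n) : List Bool := (List.finRange n).flatMap fun i => rowBits R i

/-- Copy the entry `(a, b)` of a truth table, and record its contribution to the support. -/
def readBit (a b : Fin 3) : Prog :=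
  .pop .inp (fun g c => { g with bit := c }) ;; .push .out (fun g => g.bit.getD false) ;;
    .load fun g => { g with
      sup := if g.bit.getD false = true ∧ a ∈ g.lbl then insert b g.sup else g.sup
      bit := none }

/-- Copy the listed entries of a truth table. -/
def readBits : List (Fin 3 × Fin 3) → Prog
  | [] => skip
  | ab :: l => readBit ab.1 ab.2 ;; readBits l

theorem runs_readBits (f : Fin 3 → Fin 3 → Bool) (l : List (Fin 3 × Fin 3)) (s : Mem)
    (rest : List Bool) (hs : s.g.bit = none) (hi : s.inp = l.map (fun ab => f ab.1 ab.2) ++ rest) :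
    Runs (readBits l) s
      { s with
        g := { s.g with
          sup := s.g.sup ∪ ((l.filter fun ab => f ab.1 ab.2 ∧ ab.1 ∈ s.g.lbl).map
            Prod.snd).toFinset }
        inp := rest
        out := (l.map fun ab => f ab.1 ab.2).reverse ++ s.out } (l.length * 3 + 1) := by
  induction l generalizing s with
  | nil =>
    refine (runs_load id s).mono ?_ (by simp)
    simp at hi
    simp [← hi]
  | cons ab l ih =>
    have h1 := (runs_pop_inp (fun g c => { g with bit := c }) s).seq
      ((runs_push_out (fun g => g.bit.getD false) _).seq (runs_load (fun g => { g with
        sup := if g.bit.getD false = true ∧ ab.1 ∈ g.lbl then insert ab.2 g.sup else g.sup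
        bit := none }) _))
    refine (h1.seq (ih _ rfl ?_)).mono ?_ (Nat.le_of_eq (by simp; ring))
    · simp [hi]
    · have hh : s.inp.head?.getD false = f ab.1 ab.2 := by simp [hi]
      have hsup : (if f ab.1 ab.2 = true ∧ ab.1 ∈ s.g.lbl then insert ab.2 s.g.sup else s.g.sup) ∪
          ((l.filter fun ab => f ab.1 ab.2 ∧ ab.1 ∈ s.g.lbl).map Prod.snd).toFinset =
          s.g.sup ∪ (((ab :: l).filter fun ab => f ab.1 ab.2 ∧ ab.1 ∈ s.g.lbl).map
            Prod.snd).toFinset := by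
        by_cases h2 : f ab.1 ab.2 = true ∧ ab.1 ∈ s.g.lbl
        · rw [if_pos h2, List.filter_cons_of_pos (by simpa using h2)]
          ext c
          simp only [List.map_cons, List.toFinset_cons, Finset.mem_union, Finset.mem_insert]
          tauto
        · rw [if_neg h2, List.filter_cons_of_neg (by simpa using h2)]
      simp only [hh, List.map_cons, List.reverse_cons, List.append_assoc, List.cons_append,
        List.nil_append]
      rw [hsup, hs]

/-- The positions of a truth table, in the order in which they appear in the input word. -/
def pairs : List (Fin 3 × Fin 3) :=
  (List.finRange 3).flatMap fun a => (List.finRange 3).map fun b => (a, b)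

theorem map_pairs (f : Fin 3 → Fin 3 → Bool) :
    pairs.map (fun ab => f ab.1 ab.2) = tableBits f := by
  simp [pairs, tableBits, List.map_flatMap, Function.comp_def]

theorem toFinset_filter_pairs (f : Fin 3 → Fin 3 → Bool) (s : Dom) :
    ((pairs.filter fun ab => f ab.1 ab.2 ∧ ab.1 ∈ s).map Prod.snd).toFinset = support f s := by
  ext c
  simp [pairs, support, and_comm]

/-- Store the domain of the variable marked by the innermost loop. -/
def fetch : Prog :=
  pass (.load fun g => { g with
    lbl := if (g.cur.map fun r => r.m 2).getD false then (g.cur.getD default).x else g.lbl })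

theorem runs_fetch (L : Config n) (i : Fin n) (hp : L.p 2 = i + 1) (hl : L.lbl = ∅) :
    Runs fetch L.toMem { L with lbl := L.X i }.toMem (n * 8 + 4) := by
  refine runs_pass_config (τ := 1)
    (fun k => ({ L with lbl := if (i : ℕ) < k then L.X i else ∅ } : Config n).base) _ _
    ?_ ?_ fun k hk t r => (runs_load _ _).mono ?_ le_rfl
  · simp [Config.base, hl]
  · simp [Config.base]
  · have h : (L.recs ⟨k, hk⟩).m 2 = decide (k = i) := by simp [Config.recs, hp]
    have hx : k = i → L.X ⟨k, hk⟩ = L.X i := fun e => by congr 1; exact Fin.ext e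
    simp only [Mem.at, Option.map_some, Option.getD_some, h, Config.base]
    congr 2
    rcases lt_trichotomy (i : ℕ) k with h1 | h1 | h1
    · simp [h1, h1.ne', Nat.lt_succ_of_lt h1]
    · obtain rfl : i = ⟨k, hk⟩ := Fin.ext h1
      simp [Config.recs]
    · simp [h1.ne, not_lt.2 h1.le, Nat.not_lt.2 (Nat.succ_le_of_lt h1)]

/-- Revise all domains with respect to one variable, given its domain, reading one row of truth
tables. -/
def reviseRow : Prog :=
  pass (readBits pairs ;; .load fun g => { g with
    cur := g.cur.map fun r => { r with x := r.x ∩ g.sup }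
    sup := ∅ })

theorem drop_finRange {k : ℕ} (hk : k < n) :
    (List.finRange n).drop k = ⟨k, hk⟩ :: (List.finRange n).drop (k + 1) := by
  rw [List.drop_eq_getElem_cons (by simpa using hk)]
  simp

theorem take_finRange {k : ℕ} (hk : k < n) :
    (List.finRange n).take (k + 1) = (List.finRange n).take k ++ [⟨k, hk⟩] := by
  rw [List.take_succ_eq_append_getElem (by simpa using hk)]
  simp

theorem take_finRange_self : (List.finRange n).take n = List.finRange n :=
  List.take_of_length_le (by simp)

theorem drop_finRange_self : (List.finRange n).drop n = [] :=
  List.drop_eq_nil_of_le (by simp)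

theorem runs_reviseRow (R : Rel n) (L : Config n) (i : Fin n) (rest : List Bool)
    (hi : L.inp = rowBits R i ++ rest) (hl : L.lbl = L.X i) :
    Runs reviseRow L.toMem
      { L with
        inp := rest
        out := (rowBits R i).reverse ++ L.out
        X := revise R L.X i }.toMem (n * 36 + 4) := by
  refine runs_pass_config (τ := 29) (fun k => ({ L with
      inp := (((List.finRange n).drop k).flatMap fun j => tableBits (R i j)) ++ rest
      out := (((List.finRange n).take k).flatMap fun j => tableBits (R i j)).reverse ++ L.out } :
        Config n).base) _ _ ?_ ?_ fun k hk t r => ?_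
  · simp [Config.base, hi, rowBits]
  · simp [Config.base, take_finRange_self, drop_finRange_self, rowBits]
  · refine ((runs_readBits (R i ⟨k, hk⟩) pairs _ ((((List.finRange n).drop (k + 1)).flatMap
      fun j => tableBits (R i j)) ++ rest) rfl ?_).seq (runs_load _ _)).mono ?_ (by simp [pairs])
    · simp [Config.base, Mem.at, drop_finRange hk, map_pairs]
    · simp only [toFinset_filter_pairs, map_pairs, take_finRange hk]
      simp [Config.base, Mem.at, Config.recs, revise, Reg.init, hl]

/-- Move the part of the input already read back to the input stack. -/
def rewind : Prog :=
  .pop .out (fun g c => { g with bit := c }) ;;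
  .loop (fun g => g.bit.isSome)
    (.push .inp (fun g => g.bit.getD false) ;; .pop .out (fun g c => { g with bit := c }))

theorem runs_rewind (s : Mem) (hs : s.g.bit = none) :
    Runs rewind s { s with inp := s.out.reverse ++ s.inp, out := [] } (s.out.length * 3 + 2) := by
  have h := runs_loop (p := fun g : Reg => g.bit.isSome)
    (c := .push .inp (fun g => g.bit.getD false) ;; .pop .out (fun g c => { g with bit := c }))
    (fun k => { s with
      g := { s.g with bit := s.out[k]? }
      inp := (s.out.take k).reverse ++ s.inp
      out := s.out.drop (k + 1) }) s.out.length 2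
    (fun k hk => by simp [hk])
    (fun k hk => by
      refine ((runs_push_inp _ _).seq (runs_pop_out _ _)).mono ?_ le_rfl
      simp only [List.getElem?_eq_getElem hk, Option.getD_some, List.head?_drop, List.tail_drop,
        List.take_succ_eq_append_getElem hk, List.reverse_append, List.reverse_singleton,
        List.nil_append, List.cons_append])
    (by simp)
  refine (((runs_pop_out _ _).mono ?_ le_rfl).seq h).mono ?_ (Nat.le_of_eq (by ring))
  · cases h : s.out <;> simp
  · simp [← hs]

/-- Revise the probed domains with respect to each variable in turn. -/
def sweepProg : Prog :=
  forEach 2 (fetch ;; reviseRow ;; .load fun g => { g with lbl := ∅ }) ;; rewind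

theorem length_allBits (R : Rel n) : (allBits R).length = n * (n * 9) := by
  simp [allBits, rowBits, tableBits, List.length_flatMap]

theorem runs_sweepProg (R : Rel n) (L : Config n) (hi : L.inp = allBits R) (ho : L.out = [])
    (hl : L.lbl = ∅) (hp : L.p 2 = 0) :
    Runs sweepProg L.toMem { L with X := sweep R L.X }.toMem
      (n * (n * 79 + 14) + (n * 8 + 9)) := by
  set S : ℕ → Config n := fun k => { L with
    inp := ((List.finRange n).drop k).flatMap fun i => rowBits R i
    out := (((List.finRange n).take k).flatMap fun i => rowBits R i).reverse
    X := ((List.finRange n).take k).foldl (revise R) L.X } with hS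
  have h := runs_forEach 2 (b := fetch ;; reviseRow ;; .load fun g => { g with lbl := ∅ })
    (τ := n * 44 + 9) S (fun _ => hp) fun k hk => by
      have h1 := runs_fetch ((S k).mark 2 (k + 1)) ⟨k, hk⟩ (by simp [Config.mark]) hl
      have h2 := runs_reviseRow R { (S k).mark 2 (k + 1) with lbl := (S k).X ⟨k, hk⟩ } ⟨k, hk⟩
        (((List.finRange n).drop (k + 1)).flatMap fun i => rowBits R i)
        (by simp [Config.mark, hS, drop_finRange hk]) rfl
      refine (h1.seq (h2.seq (runs_load _ _))).mono ?_ (Nat.le_of_eq (by ring))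
      simp only [hS, take_finRange hk, List.flatMap_append, List.reverse_append,
        List.foldl_append, Config.toMem, Config.mark, Config.base, Mem.at, hl]
      simp
      rfl
  have h0 : S 0 = L := by
    simp only [hS, List.drop_zero, List.take_zero, List.flatMap_nil, List.reverse_nil,
      List.foldl_nil]
    rw [show ((List.finRange n).flatMap fun i => rowBits R i) = L.inp from hi.symm, ← ho]
  have hn : (S n).toMem.out = (allBits R).reverse := by
    simp [hS, take_finRange_self, allBits, Config.toMem, Mem.at, Config.base]
  rw [h0] at h
  refine (h.seq (runs_rewind _ rfl)).mono ?_ ?_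
  · rw [hn]
    simp [hS, drop_finRange_self, take_finRange_self, Config.toMem, Mem.at, Config.base, hi, ho,
      sweep]
    rfl
  · rw [hn, List.length_reverse, length_allBits]
    exact Nat.le_of_eq (by ring)

/-- Make the probed domains arc consistent, by three sweeps for each variable. -/
def closureProg : Prog := forEach 1 (sweepProg ;; sweepProg ;; sweepProg)

theorem runs_closureProg (R : Rel n) (L : Config n) (hi : L.inp = allBits R) (ho : L.out = [])
    (hl : L.lbl = ∅) (h1 : L.p 1 = 0) (h2 : L.p 2 = 0) :
    Runs closureProg L.toMem { L with X := arcClosure R L.X }.toMem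
      (n * (n * (n * 237 + 74) + 32) + (n * 8 + 7)) := by
  have hs : ∀ X k, Runs sweepProg { L.mark 1 k with X := X }.toMem
      { L.mark 1 k with X := sweep R X }.toMem (n * (n * 79 + 14) + (n * 8 + 9)) := fun X k =>
    runs_sweepProg R { L.mark 1 k with X := X } hi ho hl (by simp [Config.mark, h2])
  have h := runs_forEach 1 (b := sweepProg ;; sweepProg ;; sweepProg)
    (τ := n * (n * 237 + 66) + 27)
    (fun k => { L with X := ((sweep R)^[3])^[k] L.X }) (fun _ => h1) fun k _ => by
      rw [Function.iterate_succ_apply']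
      exact ((hs _ (k + 1)).seq ((hs _ (k + 1)).seq (hs _ (k + 1)))).mono rfl
        (Nat.le_of_eq (by ring))
  refine h.mono ?_ (Nat.le_of_eq (by ring))
  rw [← Function.iterate_mul]
  rfl

/-! ### Probing and branching on the machine -/

/-- Prepare the probing of the label `a` at the variable marked by the outermost loop. -/
def assignProg (a : Fin 3) : Prog :=
  pass (onCur fun _ r => { r with x := if r.m 0 then r.d ∩ {a} else r.d })

theorem runs_assignProg (a : Fin 3) (L : Config n) (u : Fin n) (hp : L.p 0 = u + 1) :
    Runs (assignProg a) L.toMem { L with X := assign L.D u a }.toMem (n * 8 + 4) := by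
  refine runs_pass_onCur _ _ _ rfl fun v => ?_
  simp [Config.recs, assign, hp, Fin.ext_iff]

/-- The number of undecided variables among the first `k`. -/
def countFull (X : Table n) (k : ℕ) : ℕ :=
  ((List.finRange n).take k).countP fun v => X v = Finset.univ

theorem countFull_succ (X : Table n) {k : ℕ} (hk : k < n) :
    countFull X (k + 1) = countFull X k + if X ⟨k, hk⟩ = Finset.univ then 1 else 0 := by
  simp [countFull, take_finRange hk, List.countP_append, List.countP_singleton]

theorem countFull_self (X : Table n) : countFull X n = numFull X := by
  unfold countFull numFull
  rw [take_finRange_self, List.countP_eq_length_filter, ← List.toFinset_card_of_nodup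
    ((List.nodup_finRange n).filter _)]
  congr 1
  ext v
  simp

theorem numFull_le (X : Table n) : numFull X ≤ n :=
  (Finset.card_le_univ _).trans (by simp)

/-- Put two symbols on the counter for each variable undecided in `d`. -/
def countUp : Prog :=
  pass (.ite (fun g => (g.cur.getD default).d = Finset.univ)
    (.push .out (fun _ => true) ;; .push .out (fun _ => true)) skip)

theorem runs_countUp (L : Config n) (ho : L.out = []) :
    Runs countUp L.toMem { L with out := List.replicate (2 * numFull L.D) true }.toMem
      (n * 10 + 4) := by
  refine runs_pass_config (τ := 3)
    (fun k => ({ L with out := List.replicate (2 * countFull L.D k) true } : Config n).base) _ _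
    ?_ ?_ fun k hk t r => Runs.ite (fun h => ?_) (fun h => ?_)
  · simp [Config.base, countFull, ho]
  · simp [Config.base, countFull_self]
  · have h' : L.D ⟨k, hk⟩ = Finset.univ := of_decide_eq_true h
    refine ((runs_push_out _ _).seq (runs_push_out _ _)).mono ?_ le_rfl
    rw [countFull_succ _ hk, if_pos h', mul_add]
    simp [Mem.at, Config.base, List.replicate_succ, Config.recs]
  · have h' : ¬ L.D ⟨k, hk⟩ = Finset.univ := of_decide_eq_false h
    refine (runs_load _ _).mono ?_ one_le_two
    rw [countFull_succ _ hk, if_neg h']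
    rfl

/-- Take three symbols off the counter, as far as there are any, for each variable undecided in `x`,
and look for an empty domain. -/
def countDown : Prog :=
  pass (.load (fun g => { g with emp := g.emp || decide ((g.cur.getD default).x = ∅) }) ;;
    .ite (fun g => (g.cur.getD default).x = Finset.univ)
      (.pop .out (fun g _ => g) ;; .pop .out (fun g _ => g) ;; .pop .out (fun g _ => g)) skip)

/-- There is an empty domain among the first `k`. -/
def anyEmpty (X : Table n) (k : ℕ) : Bool :=
  ((List.finRange n).take k).any fun v => X v = ∅

theorem anyEmpty_succ (X : Table n) {k : ℕ} (hk : k < n) :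
    anyEmpty X (k + 1) = (anyEmpty X k || decide (X ⟨k, hk⟩ = ∅)) := by
  simp [anyEmpty, take_finRange hk]

theorem anyEmpty_self (X : Table n) : anyEmpty X n = decide (HasEmpty X) := by
  rw [Bool.eq_iff_iff]
  simp only [anyEmpty, take_finRange_self, List.any_eq_true, List.mem_finRange, true_and,
    decide_eq_true_eq]
  rfl

theorem runs_countDown (L : Config n) (m : ℕ) (ho : L.out = List.replicate m true)
    (he : L.emp = false) :
    Runs countDown L.toMem
      { L with
        out := List.replicate (m - 3 * numFull L.X) true
        emp := decide (HasEmpty L.X) }.toMem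
      (n * 12 + 4) := by
  refine runs_pass_config (τ := 5)
    (fun k => ({ L with
      out := List.replicate (m - 3 * countFull L.X k) true
      emp := anyEmpty L.X k } : Config n).base) _ _
    ?_ ?_ fun k hk t r => ((runs_load _ _).seq (Runs.ite (t := 3) (fun h => ?_)
      (fun h => ?_))).mono rfl le_rfl
  · simp [Config.base, countFull, ho, he, anyEmpty]
  · simp [Config.base, countFull_self, anyEmpty_self]
  · have h' : L.X ⟨k, hk⟩ = Finset.univ := of_decide_eq_true h
    refine ((runs_pop_out _ _).seq ((runs_pop_out _ _).seq (runs_pop_out _ _))).mono ?_ le_rfl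
    rw [countFull_succ _ hk, if_pos h', anyEmpty_succ _ hk]
    simp [Mem.at, Config.base, Config.recs, List.tail_replicate, Nat.sub_sub, mul_add]
    rfl
  · have h' : ¬ L.X ⟨k, hk⟩ = Finset.univ := of_decide_eq_false h
    refine (runs_load _ _).mono ?_ (by norm_num)
    rw [countFull_succ _ hk, if_neg h', anyEmpty_succ _ hk]
    rfl

/-- Note whether the counter is positive, and clear it. -/
def testCounter : Prog :=
  .pop .out (fun g c => { g with bit := c, small := c.isSome }) ;;
  .loop (fun g => g.bit.isSome) (.pop .out (fun g c => { g with bit := c }))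

theorem runs_testCounter (s : Mem) (hs : s.g.bit = none) :
    Runs testCounter s
      { s with g := { s.g with small := decide (0 < s.out.length) }, out := [] }
      (s.out.length * 2 + 2) := by
  have h := runs_loop (p := fun g : Reg => g.bit.isSome)
    (c := .pop .out (fun g c => { g with bit := c }))
    (fun k => { s with
      g := { s.g with bit := s.out[k]?, small := decide (0 < s.out.length) }
      out := s.out.drop (k + 1) }) s.out.length 1
    (fun k hk => by simp [hk])
    (fun k hk => (runs_pop_out _ _).mono (by simp) le_rfl)
    (by simp)
  refine (((runs_pop_out _ _).mono ?_ le_rfl).seq h).mono ?_ (Nat.le_of_eq (by ring))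
  · cases h : s.out <;> simp
  · simp [← hs]

/-- Decide whether the probed label is contradictory and whether it is shrinking. -/
def measureProg : Prog := countUp ;; countDown ;; testCounter

theorem runs_measureProg (L : Config n) (ho : L.out = []) (he : L.emp = false) :
    Runs measureProg L.toMem
      { L with
        emp := decide (HasEmpty L.X)
        small := decide (3 * numFull L.X < 2 * numFull L.D) }.toMem (n * 26 + 10) := by
  have h1 := runs_countUp L ho
  have h2 := runs_countDown { L with out := List.replicate (2 * numFull L.D) true }
    (2 * numFull L.D) rfl he
  refine (h1.seq (h2.seq (runs_testCounter _ rfl))).mono ?_ ?_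
  · simp [Config.toMem, Config.base, Mem.at, ho, Reg.init]
    rfl
  · have := numFull_le L.D
    simp [Config.toMem, Config.base, Mem.at]
    omega

/-- Put the table of the domains chosen by `f` on the work list. -/
def pushTable (f : Rec → Dom) : Prog :=
  pass (.push .work fun g => f (g.cur.getD default))

theorem runs_pushTable (f : Rec → Dom) (L : Config n) (X : Table n)
    (hX : ∀ v, f (L.recs v) = X v) :
    Runs (pushTable f) L.toMem { L with W := (List.ofFn X).reverse ++ L.W }.toMem (n * 8 + 4) := by
  refine runs_pass_config (τ := 1)
    (fun k => ({ L with W := (((List.finRange n).take k).map X).reverse ++ L.W } : Config n).base)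
    _ _ ?_ ?_ fun k hk t r => ?_
  · simp [Config.base]
  · simp [Config.base, take_finRange_self, List.ofFn_eq_map]
  · refine (runs_push_work _ _).mono ?_ le_rfl
    rw [take_finRange hk]
    simp [Mem.at, Config.base, ← hX]
    rfl

/-- Several tables on the work list. -/
def stackOf (l : List (Table n)) : List Dom := l.flatMap fun X => (List.ofFn X).reverse

/-- Remove the label `a` at the variable `u` if it is contradictory or shrinking. -/
def cut (R : Rel n) (D : Table n) (u : Fin n) (E : Table n) (a : Fin 3) : Table n :=
  if HasEmpty (probe R D u a) ∨ Shrinks R D u a then Function.update E u ((E u).erase a) else E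

theorem cut_apply (R : Rel n) (D : Table n) (u : Fin n) (E : Table n) (a : Fin 3) (v : Fin n) :
    cut R D u E a v =
      if v = u ∧ (HasEmpty (probe R D u a) ∨ Shrinks R D u a) then (E v).erase a else E v := by
  unfold cut
  by_cases hb : HasEmpty (probe R D u a) ∨ Shrinks R D u a
  · by_cases hv : v = u
    · subst hv; simp [hb]
    · simp [hb, hv]
  · simp [hb]

/-- Probe the label `a` at the variable marked by the outermost loop. -/
def probeProg (a : Fin 3) : Prog :=
  assignProg a ;; closureProg ;; measureProg ;;
  .ite (fun g => !g.emp && g.small) (pushTable Rec.x) skip ;;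
  pass (onCur fun g r => { r with
    e := if r.m 0 && (g.emp || g.small) then r.e.erase a else r.e
    x := ∅ }) ;;
  .load fun g => { g with emp := false, small := false }

/-- A bound for the running time of `probeProg`. -/
def probeTime (n : ℕ) : ℕ := n * (n * (n * 237 + 74) + 32) + n * 58 + 31

theorem runs_probeProg (R : Rel n) (a : Fin 3) (L : Config n) (u : Fin n) (h0 : L.p 0 = u + 1)
    (hi : L.inp = allBits R) (ho : L.out = []) (hl : L.lbl = ∅) (h1 : L.p 1 = 0) (h2 : L.p 2 = 0)
    (he : L.emp = false) (hs : L.small = false) (hX : L.X = fun _ => ∅) :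
    Runs (probeProg a) L.toMem
      { L with
        E := cut R L.D u L.E a
        W := stackOf (branch R L.D u a) ++ L.W }.toMem (probeTime n) := by
  have r1 := runs_assignProg a L u h0
  have r2 := runs_closureProg R { L with X := assign L.D u a } hi ho hl h1 h2
  have r3 := runs_measureProg { L with X := probe R L.D u a } ho he
  set L3 : Config n := { L with
    X := probe R L.D u a
    emp := decide (HasEmpty (probe R L.D u a))
    small := decide (3 * numFull (probe R L.D u a) < 2 * numFull L.D) } with hL3
  have r4 : Runs (.ite (fun g => !g.emp && g.small) (pushTable Rec.x) skip) L3.toMem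
      { L3 with W := stackOf (branch R L.D u a) ++ L.W }.toMem (n * 8 + 5) := by
    refine Runs.ite (fun h => ?_) (fun h => ?_)
    · have h' : ¬ HasEmpty (probe R L.D u a) ∧ Shrinks R L.D u a := by
        simpa [hL3, Config.toMem, Mem.at, Config.base, Shrinks] using h
      refine (runs_pushTable Rec.x L3 (probe R L.D u a) fun v => rfl).mono ?_ le_rfl
      simp [branch, h', stackOf, hL3]
    · have h' : ¬ (¬ HasEmpty (probe R L.D u a) ∧ Shrinks R L.D u a) := by
        simpa [hL3, Config.toMem, Mem.at, Config.base, Shrinks] using h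
      refine (runs_load id L3.toMem).mono ?_ (by omega)
      rw [branch, if_neg h']
      simp [stackOf, hL3]
  have r5 := runs_pass_onCur (fun g r => { r with
      e := if r.m 0 && (g.emp || g.small) then r.e.erase a else r.e
      x := ∅ })
    { L3 with W := stackOf (branch R L.D u a) ++ L.W }
    { L3 with W := stackOf (branch R L.D u a) ++ L.W, X := fun _ => ∅, E := cut R L.D u L.E a }
    rfl fun v => by
      simp only [Config.recs, Mem.at, Config.base, hL3, h0, cut_apply]
      congr 1
      refine if_congr ?_ rfl rfl
      simp [Shrinks, Fin.ext_iff]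
  refine (r1.seq (r2.seq (r3.seq (r4.seq (r5.seq (runs_load _ _)))))).mono ?_ ?_
  · simp [hL3, Config.toMem, Mem.at, Config.base, he, hs, hX]
    rfl
  · unfold probeTime
    refine Nat.le_of_eq ?_
    ring

/-! ### The search -/

theorem stackOf_append (l l' : List (Table n)) : stackOf (l ++ l') = stackOf l ++ stackOf l' := by
  simp [stackOf]

/-- Probe all labels at all variables: put the branches on the work list and prune. -/
def branchProg : Prog := forEach 0 (probeProg 0 ;; probeProg 1 ;; probeProg 2)

theorem cut_cut_cut (R : Rel n) (D : Table n) (u : Fin n) (E : Table n) (hE : E u = D u) :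
    cut R D u (cut R D u (cut R D u E 0) 1) 2 = Function.update E u (prune R D u) := by
  funext v
  by_cases hv : v = u
  · subst hv
    ext c
    simp only [cut_apply, true_and, hE, Function.update_self, prune, Finset.mem_filter]
    fin_cases c <;> split_ifs <;> simp_all
  · simp [cut_apply, hv]

theorem runs_branchProg (R : Rel n) (L : Config n) (hi : L.inp = allBits R) (ho : L.out = [])
    (hl : L.lbl = ∅) (hp : ∀ k, L.p k = 0) (he : L.emp = false) (hs : L.small = false)
    (hX : L.X = fun _ => ∅) (hE : L.E = L.D) :
    Runs branchProg L.toMem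
      { L with
        E := prune R L.D
        W := stackOf (branches R L.D).reverse ++ L.W }.toMem
      (n * (probeTime n * 3 + n * 8 + 5) + (n * 8 + 7)) := by
  set S : ℕ → Config n := fun k => { L with
    E := fun v => if (v : ℕ) < k then prune R L.D v else L.D v
    W := stackOf (((List.finRange n).take k).flatMap fun u => (List.finRange 3).flatMap fun a =>
      branch R L.D u a).reverse ++ L.W } with hS
  have h := runs_forEach 0 (b := probeProg 0 ;; probeProg 1 ;; probeProg 2)
    (τ := probeTime n * 3) S (fun _ => hp 0) fun k hk => by
      have hr := fun (a : Fin 3) (E : Table n) (W : List Dom) =>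
        runs_probeProg R a { (S k).mark 0 (k + 1) with E := E, W := W } ⟨k, hk⟩
        (by simp [Config.mark]) hi ho hl (by simp [Config.mark, hS, hp])
        (by simp [Config.mark, hS, hp]) he hs hX
      refine ((hr 0 (S k).E (S k).W).seq ((hr 1 _ _).seq (hr 2 _ _))).mono ?_
        (Nat.le_of_eq (by ring))
      have e1 : cut R L.D ⟨k, hk⟩ (cut R L.D ⟨k, hk⟩ (cut R L.D ⟨k, hk⟩ (S k).E 0) 1) 2 =
          (S (k + 1)).E := by
        rw [cut_cut_cut _ _ _ _ (by simp [hS])]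
        funext v
        by_cases hv : v = ⟨k, hk⟩
        · subst hv; simp [hS]
        · have hv' : (v : ℕ) ≠ k := fun h => hv (Fin.ext h)
          have : (v : ℕ) < k + 1 ↔ (v : ℕ) < k := by omega
          simp only [hS, Function.update_of_ne hv, this]
      have e2 : stackOf (branch R L.D ⟨k, hk⟩ 2) ++ (stackOf (branch R L.D ⟨k, hk⟩ 1) ++
          (stackOf (branch R L.D ⟨k, hk⟩ 0) ++ (S k).W)) = (S (k + 1)).W := by
        have hrev : ∀ a, (branch R L.D ⟨k, hk⟩ a).reverse = branch R L.D ⟨k, hk⟩ a := by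
          intro a
          unfold branch
          split_ifs <;> rfl
        have h3 : List.finRange 3 = [0, 1, 2] := rfl
        simp only [hS, take_finRange hk, List.flatMap_append, List.reverse_append, stackOf_append,
          List.flatMap_cons, List.flatMap_nil, h3, List.append_nil, hrev, List.append_assoc]
      have e3 : ∀ (E E' : Table n) (W W' : List Dom), E = E' → W = W' →
          ({ (S k).mark 0 (k + 1) with E := E, W := W } : Config n).toMem =
          ({ (S k).mark 0 (k + 1) with E := E', W := W' } : Config n).toMem := by
        rintro E _ W _ rfl rfl
        rfl
      exact e3 _ _ _ _ e1 e2
  have h0 : S 0 = L := by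
    have : ∀ M : Config n, M.E = M.D → { M with E := M.D } = M := by
      rintro ⟨⟩ h
      dsimp only at h
      subst h
      rfl
    rw [← this L hE]
    simp [hS, stackOf]
  rw [h0] at h
  refine h.mono ?_ le_rfl
  simp only [hS, take_finRange_self, Fin.is_lt, if_true]
  rfl

/-- Put the pruned table on the work list if something was undecided, and otherwise note whether the
table is accepted. -/
def finishProg : Prog :=
  pass (.load fun g => { g with
    emp := g.emp || decide ((g.cur.getD default).e = ∅)
    small := g.small || decide ((g.cur.getD default).d = Finset.univ) }) ;;
  .ite Reg.small (pushTable Rec.e) (.load fun g => { g with ans := g.ans || !g.emp }) ;;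
  .load fun g => { g with emp := false, small := false }

open Classical in
theorem runs_finishProg (R : Rel n) (L : Config n) (hE : L.E = prune R L.D)
    (he : L.emp = false) (hs : L.small = false) :
    Runs finishProg L.toMem
      { L with
        W := stackOf (if numFull L.D = 0 then [] else [prune R L.D]) ++ L.W
        ans := L.ans || decide (Accepts R L.D) }.toMem (n * 16 + 10) := by
  have r1 := runs_pass_config (τ := 1) (b := .load fun g => { g with
      emp := g.emp || decide ((g.cur.getD default).e = ∅)
      small := g.small || decide ((g.cur.getD default).d = Finset.univ) })
    (fun k => ({ L with
      emp := anyEmpty L.E k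
      small := decide (0 < countFull L.D k) } : Config n).base) L
    { L with emp := decide (HasEmpty L.E), small := decide (0 < numFull L.D) }
    (by simp [Config.base, anyEmpty, countFull, he, hs])
    (by simp [Config.base, anyEmpty_self, countFull_self]) fun k hk t r => by
      refine (runs_load _ _).mono ?_ le_rfl
      rw [countFull_succ _ hk, anyEmpty_succ _ hk]
      have : decide (0 < countFull L.D k + if L.D ⟨k, hk⟩ = Finset.univ then 1 else 0) =
          (decide (0 < countFull L.D k) || decide (L.D ⟨k, hk⟩ = Finset.univ)) := by
        split_ifs with h <;> simp [h]
      rw [this]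
      rfl
  have r2 : Runs (.ite Reg.small (pushTable Rec.e) (.load fun g => { g with
      ans := g.ans || !g.emp }))
      { L with emp := decide (HasEmpty L.E), small := decide (0 < numFull L.D) }.toMem
      { L with
        emp := decide (HasEmpty L.E)
        small := decide (0 < numFull L.D)
        W := stackOf (if numFull L.D = 0 then [] else [prune R L.D]) ++ L.W
        ans := L.ans || decide (Accepts R L.D) }.toMem (n * 8 + 5) := by
    refine Runs.ite (fun h => ?_) (fun h => ?_)
    · have h' : numFull L.D ≠ 0 := Nat.pos_iff_ne_zero.1 (of_decide_eq_true h)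
      refine (runs_pushTable Rec.e
        { L with emp := decide (HasEmpty L.E), small := decide (0 < numFull L.D) } L.E
        fun v => rfl).mono ?_ le_rfl
      simp [h', Accepts, stackOf, hE]
    · have h' : numFull L.D = 0 := by
        have : ¬ 0 < numFull L.D := of_decide_eq_false h
        omega
      refine (runs_load _ _).mono ?_ (by omega)
      have h2 : decide (Accepts R L.D) = !decide (HasEmpty L.E) := by
        rw [Bool.eq_iff_iff]
        simp [Accepts, h', hE, HasEmpty, Finset.nonempty_iff_ne_empty]
      rw [h2]
      simp [h', stackOf, Config.toMem, Config.base, Mem.at]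
      rfl
  refine (r1.seq (r2.seq (runs_load _ _))).mono ?_ (Nat.le_of_eq (by ring))
  simp [Config.toMem, Config.base, Mem.at, he, hs]
  rfl

/-- Take a table from the work list. -/
def loadProg : Prog :=
  forth skip ;; back (.pop .work fun g c => { g with
    cur := g.cur.map fun r => { r with d := c.getD ∅, e := c.getD ∅ } })

theorem runs_loadProg (L : Config n) (D : Table n) (rest : List Dom)
    (hW : L.W = (List.ofFn D).reverse ++ rest) :
    Runs loadProg L.toMem { L with D := D, E := D, W := rest }.toMem (n * 8 + 4) := by
  have h1 := runs_forth (b := skip) (τ := 1) (fun _ => L.base) (List.ofFn L.recs)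
    (List.ofFn L.recs) rfl (fun k h t r => runs_load id _) []
  have h2 := runs_back (b := .pop .work fun g c => { g with
      cur := g.cur.map fun r => { r with d := c.getD ∅, e := c.getD ∅ } }) (τ := 1)
    (fun k => ({ L with W := (List.ofFn D).reverse.drop k ++ rest } : Config n).base)
    (List.ofFn L.recs).reverse
    (List.ofFn ({ L with D := D, E := D, W := rest } : Config n).recs).reverse (by simp)
    (fun k h t r => by
      have hk : k < n := by simpa using h
      have hk' : k < (List.ofFn D).reverse.length := by simpa using hk
      refine (runs_pop_work _ _).mono ?_ le_rfl
      simp [Mem.at, Config.base, List.drop_eq_getElem_cons hk', Config.recs]) []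
  simp only [List.length_ofFn, List.append_nil, List.length_reverse, List.reverse_reverse] at h1 h2
  refine ((h1.mono ?_ le_rfl).seq h2).mono ?_ (Nat.le_of_eq (by ring))
  · simp [Config.base, hW]
  · rw [List.drop_eq_nil_of_le (by simp)]
    rfl

/-- Replace the first table of the work list by its subproblems. -/
def processProg : Prog := loadProg ;; branchProg ;; finishProg

/-- The running time of `processProg`. -/
def processTime (n : ℕ) : ℕ := n * (probeTime n * 3 + n * 8 + 5) + n * 32 + 21

open Classical in
theorem runs_processProg (R : Rel n) (L : Config n) (D : Table n) (rest : List (Table n))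
    (hW : L.W = stackOf (D :: rest)) (hi : L.inp = allBits R) (ho : L.out = [])
    (hl : L.lbl = ∅) (hp : ∀ k, L.p k = 0) (he : L.emp = false) (hs : L.small = false)
    (hX : L.X = fun _ => ∅) :
    Runs processProg L.toMem
      { L with
        D := D
        E := prune R D
        W := stackOf (children R D ++ rest)
        ans := L.ans || decide (Accepts R D) }.toMem (processTime n) := by
  have r1 := runs_loadProg L D (stackOf rest) (by simpa [stackOf] using hW)
  have r2 := runs_branchProg R { L with D := D, E := D, W := stackOf rest } hi ho hl hp he hs hX
    rfl
  have r3 := runs_finishProg R { L with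
    D := D
    E := prune R D
    W := stackOf (branches R D).reverse ++ stackOf rest } rfl he hs
  refine (r1.seq (r2.seq r3)).mono ?_ (Nat.le_of_eq (by unfold processTime; ring))
  simp only [children, stackOf_append, List.append_assoc]

/-- One step of the search. The symbol taken to see whether the work list is empty is put back
first. -/
def searchBody : Prog :=
  .push .work (fun g => g.nxt.getD ∅) ;; .load (fun g => { g with nxt := none }) ;;
    processProg ;; .pop .work fun g c => { g with nxt := c }

/-- Process the tables on the work list, which each step replaces by its subproblems. -/
def searchProg : Prog :=
  .pop .work (fun g c => { g with nxt := c }) ;; .loop (fun g => g.nxt.isSome) searchBody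

/-- The memory after an attempt to take a symbol from the work list. -/
def Config.peeked (L : Config n) : Mem :=
  { L.toMem with g := { L.toMem.g with nxt := L.W.head? }, work := L.W.tail }

open Classical in
/-- Each step lowers the total weight `w` of the tables on the work list. Without variables the
number of tables on the work list would not be visible, hence the assumption `0 < n`. -/
theorem runs_searchLoop (hn : 0 < n) {R : Rel n} (hsymm : ∀ i j a b, R i j a b = R j i b a)
    (hcomp : ∀ i j, i ≠ j → ∃ a b, R i j a b = false) (w : ℕ) (l : List (Table n)) (L : Config n)
    (hw : (l.map weight).sum ≤ w) (hW : L.W = stackOf l) (hi : L.inp = allBits R)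
    (ho : L.out = []) (hl : L.lbl = ∅) (hp : ∀ k, L.p k = 0) (he : L.emp = false)
    (hs : L.small = false) (hX : L.X = fun _ => ∅) :
    ∃ D E : Table n, Runs (.loop (fun g => g.nxt.isSome) searchBody) L.peeked
      { L with
        D := D
        E := E
        W := []
        ans := L.ans || decide (∃ C ∈ l, Solvable R C) }.toMem (w * (processTime n + 4) + 1) := by
  induction w generalizing l L with
  | zero =>
    have hnil : l = [] := by
      rcases l with _ | ⟨D, l⟩
      · rfl
      · have := sum_weight_children hcomp D
        simp at hw
        omega
    subst hnil
    have hW' : L.W = [] := by simpa [stackOf] using hW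
    refine ⟨L.D, L.E, Runs.mono (s'' := L.peeked) (RunsOn.loop_false ?_) ?_ (by omega)⟩
    · simp [Config.peeked, hW']
    · simp [Config.peeked, hW', Config.toMem, Config.base, Mem.at]
      exact ⟨rfl, rfl⟩
  | succ w ih =>
    rcases l with _ | ⟨D, l⟩
    · obtain ⟨D, E, h⟩ := ih [] L (by simp) hW hi ho hl hp he hs hX
      exact ⟨D, E, h.mono rfl (by gcongr; omega)⟩
    · have hwt := sum_weight_children hcomp D
      obtain ⟨D', E', h⟩ := ih (children R D ++ l)
        { L with
          D := D
          E := prune R D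
          W := stackOf (children R D ++ l)
          ans := L.ans || decide (Accepts R D) }
        (by simp at hw ⊢; omega) rfl hi ho hl hp he hs hX
      refine ⟨D', E', ?_⟩
      have hlen : 0 < L.W.length := by simp [hW, stackOf, hn]
      obtain ⟨x, W, hxW⟩ := List.exists_cons_of_length_pos hlen
      have r0 := runs_processProg R L D l hW hi ho hl hp he hs hX
      have r : Runs searchBody L.peeked
          { L with
            D := D
            E := prune R D
            W := stackOf (children R D ++ l)
            ans := L.ans || decide (Accepts R D) : Config n }.peeked (processTime n + 3) := by
        refine ((runs_push_work _ _).seq (((runs_load _ _).mono ?_ le_rfl).seq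
          (r0.seq (runs_pop_work _ _)))).mono rfl (Nat.le_of_eq (by ring))
        simp [Config.peeked, Config.toMem, Config.base, Mem.at, hxW]
        rfl
      refine Runs.mono (RunsOn.loop_true ?_ r h) ?_ (Nat.le_of_eq (by ring))
      · simp [Config.peeked, hxW]
      · have : (decide (Accepts R D) || decide (∃ C ∈ children R D ++ l, Solvable R C)) =
            decide (∃ C ∈ D :: l, Solvable R C) := by
          rw [Bool.eq_iff_iff]
          simp only [Bool.or_eq_true, decide_eq_true_eq, List.mem_append, List.mem_cons,
            or_and_right, exists_or, exists_eq_left, solvable_iff hsymm D, or_assoc]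
        rw [← this, ← Bool.or_assoc]

/-- The search tree of an instance on `n` variables has at most this many tables. -/
def searchSize (n : ℕ) : ℕ := (3 * n + 2) ^ Nat.log 2 (2 * n ^ 2)

theorem weight_le (X : Table n) : weight X ≤ searchSize n := by
  refine Nat.pow_le_pow_right (by omega) (Nat.log_mono_right ?_)
  have := Nat.pow_le_pow_left (numFull_le X) 2
  omega

/-- Read the number of variables, and put the table that leaves everything open on the work list.
The instance without variables is satisfiable, which is recorded here because it gives an empty
work list. -/
def initProg : Prog :=
  .load (fun g => { g with ans := true }) ;; .pop .inp (fun g c => { g with bit := c }) ;;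
  .loop (fun g => g.bit.getD false)
    (.push .tab (fun _ => default) ;; .push .work (fun _ => Finset.univ) ;;
      .load (fun g => { g with ans := false }) ;; .pop .inp (fun g c => { g with bit := c })) ;;
  .load fun g => { g with bit := none }

/-- The initial memory without the input word. -/
def emptyMem : Mem := ⟨Reg.init, [], [], [], [], []⟩

/-- The configuration in which the search starts. -/
def startConfig (R : Rel n) : Config n :=
  { inp := allBits R
    out := []
    D := fun _ => ∅
    E := fun _ => ∅
    X := fun _ => ∅
    p := fun _ => 0
    W := stackOf (n := n) [fun _ => Finset.univ]
    lbl := ∅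
    emp := false
    small := false
    ans := decide (n = 0) }

theorem runs_initProg (R : Rel n) :
    Runs initProg { emptyMem with inp := List.replicate n true ++ false :: allBits R }
      (startConfig R).toMem (n * 5 + 4) := by
  have h := runs_loop (p := fun g : Reg => g.bit.getD false)
    (c := .push .tab (fun _ => default) ;; .push .work (fun _ => Finset.univ) ;;
      .load (fun g => { g with ans := false }) ;; .pop .inp (fun g c => { g with bit := c }))
    (fun k => { emptyMem with
      g := { Reg.init with
        ans := decide (k = 0)
        bit := (List.replicate (n - k) true ++ false :: allBits R).head? }
      inp := (List.replicate (n - k) true ++ false :: allBits R).tail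
      tab := List.replicate k default
      work := List.replicate k Finset.univ }) n 4
    (fun k hk => by
      obtain ⟨m, hm⟩ : ∃ m, n - k = m + 1 := ⟨n - k - 1, by omega⟩
      simp [hm, List.replicate_succ])
    (fun k hk => by
      refine ((runs_push_tab _ _).seq ((runs_push_work _ _).seq ((runs_load _ _).seq
        (runs_pop_inp _ _)))).mono ?_ le_rfl
      obtain ⟨m, hm⟩ : ∃ m, n - k = m + 1 := ⟨n - k - 1, by omega⟩
      have hm' : n - (k + 1) = m := by omega
      simp [hm, hm', List.replicate_succ])
    (by simp)
  refine ((runs_load _ _).seq (((runs_pop_inp _ _).mono ?_ le_rfl).seq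
    (h.seq (runs_load _ _)))).mono ?_ (Nat.le_of_eq (by ring))
  · simp [emptyMem]
  · have h1 : (startConfig R).recs = fun _ => default := by
      funext v
      simp [startConfig, Config.recs]
      rfl
    simp only [Config.toMem, h1]
    simp [emptyMem, startConfig, Config.base, Mem.at, stackOf]
    exact ⟨rfl, rfl, rfl, rfl, rfl⟩

/-- Leave nothing but the answer. -/
def cleanProg : Prog :=
  .pop .tab (fun g c => { g with cur := c }) ;;
  .loop (fun g => g.cur.isSome) (.pop .tab fun g c => { g with cur := c }) ;;
  .pop .inp (fun g c => { g with bit := c }) ;;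
  .loop (fun g => g.bit.isSome) (.pop .inp fun g c => { g with bit := c }) ;;
  .push .out Reg.ans ;; .load fun _ => Reg.init

theorem runs_cleanProg (L : Config n) (ho : L.out = []) (hW : L.W = []) :
    Runs cleanProg L.toMem { emptyMem with out := [L.ans] } (n * 2 + L.inp.length * 2 + 6) := by
  set s := L.toMem with hs
  have h1 := runs_loop (p := fun g : Reg => g.cur.isSome)
    (c := .pop .tab fun g c => { g with cur := c })
    (fun k => { s with g := { s.g with cur := s.tab[k]? }, tab := s.tab.drop (k + 1) })
    s.tab.length 1 (fun k hk => by simp [hk])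
    (fun k hk => (runs_pop_tab _ _).mono (by simp) le_rfl) (by simp)
  have h2 := runs_loop (p := fun g : Reg => g.bit.isSome)
    (c := .pop .inp fun g c => { g with bit := c })
    (fun k => { s with
      g := { s.g with cur := none, bit := s.inp[k]? }
      inp := s.inp.drop (k + 1)
      tab := [] }) s.inp.length 1 (fun k hk => by simp [hk])
    (fun k hk => (runs_pop_inp _ _).mono (by simp) le_rfl) (by simp)
  refine (((runs_pop_tab _ _).mono ?_ le_rfl).seq (h1.seq (((runs_pop_inp _ _).mono ?_
    le_rfl).seq (h2.seq ((runs_push_out _ _).seq (runs_load _ _)))))).mono ?_ ?_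
  · cases h : s.tab <;> simp
  · cases h : s.inp <;> simp
  · simp [hs, Config.toMem, Config.base, Mem.at, ho, hW, emptyMem]
  · simp [hs, Config.toMem, Config.base, Mem.at]
    omega

/-- The whole algorithm. -/
def mainProg : Prog := initProg ;; searchProg ;; cleanProg

/-- A bound for the running time of `mainProg`. -/
def mainTime (n : ℕ) : ℕ :=
  searchSize n * (processTime n + 4) + (n * (n * 18) + n * 7 + 12)

open Classical in
theorem runs_mainProg {R : Rel n} (hsymm : ∀ i j a b, R i j a b = R j i b a)
    (hcomp : ∀ i j, i ≠ j → ∃ a b, R i j a b = false) :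
    Runs mainProg { emptyMem with inp := List.replicate n true ++ false :: allBits R }
      { emptyMem with out := [decide (Solvable R fun _ => Finset.univ)] } (mainTime n) := by
  have h : ∃ L : Config n, Runs searchProg (startConfig R).toMem L.toMem
      (searchSize n * (processTime n + 4) + 2) ∧ L.inp = allBits R ∧ L.out = [] ∧ L.W = [] ∧
      L.ans = decide (Solvable R fun _ => Finset.univ) := by
    have hpop := runs_pop_work (fun g c => { g with nxt := c }) (startConfig R).toMem
    rcases Nat.eq_zero_or_pos n with rfl | hn
    · refine ⟨startConfig R, (hpop.seq (RunsOn.loop_false rfl)).mono rfl (by omega), rfl, rfl,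
        rfl, ?_⟩
      have : Solvable R fun _ => Finset.univ := ⟨fun v => v.elim0, fun v => v.elim0,
        fun v => v.elim0⟩
      simp [startConfig, this]
    · obtain ⟨D, E, h⟩ := runs_searchLoop hn hsymm hcomp (searchSize n)
        [fun _ => Finset.univ] (startConfig R) (by simpa using weight_le _) rfl rfl rfl rfl
        (fun _ => rfl) rfl rfl rfl
      refine ⟨_, (hpop.seq h).mono rfl (by omega), rfl, rfl, rfl, ?_⟩
      simp [startConfig, hn.ne']
  obtain ⟨L, hL, hi, ho, hW, ha⟩ := h
  refine ((runs_initProg R).seq (hL.seq (runs_cleanProg L ho hW))).mono (by rw [ha]) ?_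
  rw [hi, length_allBits]
  unfold mainTime
  refine Nat.le_of_eq ?_
  ring

/-! ### The running time -/

theorem probeTime_le (hn : 1 ≤ n) : probeTime n ≤ 432 * n ^ 3 := by
  have h2 : n ≤ n ^ 2 := Nat.le_self_pow two_ne_zero n
  have h3 : n ^ 2 ≤ n ^ 3 := Nat.pow_le_pow_right hn (by norm_num)
  calc probeTime n = 237 * n ^ 3 + 74 * n ^ 2 + 90 * n + 31 := by unfold probeTime; ring
    _ ≤ 432 * n ^ 3 := by omega

theorem processTime_le (hn : 1 ≤ n) : processTime n ≤ 1362 * n ^ 4 := by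
  have h2 : n ≤ n ^ 2 := Nat.le_self_pow two_ne_zero n
  have h3 : n ^ 2 ≤ n ^ 4 := Nat.pow_le_pow_right hn (by norm_num)
  calc processTime n = 3 * (n * probeTime n) + 8 * n ^ 2 + 37 * n + 21 := by
        unfold processTime; ring
    _ ≤ 3 * (n * (432 * n ^ 3)) + 8 * n ^ 2 + 37 * n + 21 := by gcongr; exact probeTime_le hn
    _ = 1296 * n ^ 4 + 8 * n ^ 2 + 37 * n + 21 := by ring
    _ ≤ 1362 * n ^ 4 := by omega

theorem searchSize_le (hn : 2 ≤ n) : searchSize n ≤ n ^ (6 * Nat.log 2 n + 6) := by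
  have h1 : Nat.log 2 (2 * n ^ 2) < 2 * Nat.log 2 n + 3 := by
    apply Nat.log_lt_of_lt_pow (by positivity)
    have := Nat.pow_lt_pow_left (Nat.lt_pow_succ_log_self (b := 2) one_lt_two n) two_ne_zero
    calc 2 * n ^ 2 < 2 * (2 ^ (Nat.log 2 n + 1)) ^ 2 :=
          (Nat.mul_lt_mul_left two_pos).2 this
      _ = 2 ^ (2 * Nat.log 2 n + 3) := by ring
  have h2 : 3 * n + 2 ≤ n ^ 3 := by nlinarith [Nat.mul_le_mul hn hn]
  calc searchSize n ≤ (n ^ 3) ^ Nat.log 2 (2 * n ^ 2) := Nat.pow_le_pow_left h2 _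
    _ ≤ (n ^ 3) ^ (2 * Nat.log 2 n + 2) := Nat.pow_le_pow_right (by positivity) (by omega)
    _ = n ^ (6 * Nat.log 2 n + 6) := by rw [← pow_mul]; congr 1; ring

theorem mainTime_le (hn : 2 ≤ n) : mainTime n ≤ n ^ (27 * Nat.log 2 n) := by
  have hS : 1 ≤ searchSize n := Nat.one_le_pow _ _ (by omega)
  have h2 : n ≤ n ^ 2 := Nat.le_self_pow two_ne_zero n
  have h3 : n ^ 2 ≤ n ^ 4 := Nat.pow_le_pow_right (by omega) (by norm_num)
  have hP := processTime_le (n := n) (by omega)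
  have hlog : 1 ≤ Nat.log 2 n := Nat.log_pos one_lt_two hn
  calc mainTime n ≤ searchSize n * (processTime n + 4) +
        searchSize n * (n * (n * 18) + n * 7 + 12) :=
        Nat.add_le_add_left (Nat.le_mul_of_pos_left _ hS) _
    _ = searchSize n * (processTime n + (18 * n ^ 2 + 7 * n + 16)) := by ring
    _ ≤ searchSize n * (2 ^ 11 * n ^ 4) := by gcongr; omega
    _ ≤ n ^ (6 * Nat.log 2 n + 6) * (n ^ 11 * n ^ 4) := by
        gcongr
        exact searchSize_le hn
    _ = n ^ (6 * Nat.log 2 n + 21) := by ring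
    _ ≤ n ^ (27 * Nat.log 2 n) := Nat.pow_le_pow_right (by omega) (by omega)

/-! ### Instances and their truth tables -/

theorem pair_mem_iff {I : CSP 2 3 n} (hI : I.IsComplete) (i j : Fin n) :
    {i, j} ∈ I.constraints ↔ i ≠ j := by
  constructor
  · rintro h rfl
    have := I.card_eq _ h
    simp at this
  · exact fun h => hI.1 _ (Finset.card_pair h)

theorem allows_symm (I : CSP 2 3 n) (i j : Fin n) (a b : Fin 3) :
    I.allows i j a b = I.allows j i b a := by
  unfold CSP.allows
  by_cases hij : i = j
  · subst hij
    have : {i, i} ∉ I.constraints := fun h => by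
      have := I.card_eq _ h
      simp at this
    rw [dif_neg this, dif_neg this]
  · have key : ∀ (C C' : Finset (Fin n)) (f g : Fin n → Fin 3), C = C' → (∀ v ∈ C, f v = g v) →
        (if h : C ∈ I.constraints then I.pred C h fun v _ => f v else true) =
          if h : C' ∈ I.constraints then I.pred C' h fun v _ => g v else true := by
      rintro C _ f g rfl hfg
      split_ifs with h
      · congr 1
        funext v hv
        exact hfg v hv
      · rfl
    refine key _ _ (fun v => if v = i then a else b) (fun v => if v = j then b else a)
      (Finset.pair_comm i j) fun v hv => ?_
    rcases Finset.mem_insert.1 hv with rfl | hv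
    · simp [hij]
    · rw [Finset.mem_singleton.1 hv]
      simp [Ne.symm hij]

theorem exists_not_allows {I : CSP 2 3 n} (hI : I.IsComplete) {i j : Fin n} (hij : i ≠ j) :
    ∃ a b, I.allows i j a b = false := by
  have h := (pair_mem_iff hI i j).2 hij
  obtain ⟨σ, hσ⟩ := hI.2 _ h
  refine ⟨σ i (by simp), σ j (by simp), ?_⟩
  unfold CSP.allows
  rw [dif_pos h, ← hσ]
  congr 1
  funext v hv
  by_cases hv' : v = i
  · subst hv'; simp
  · obtain rfl : v = j := by simpa [hv'] using hv
    simp [hv']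

theorem solvable_allows_iff (I : CSP 2 3 n) :
    Solvable I.allows (fun _ => Finset.univ) ↔ I.Satisfiable := by
  have key : ∀ (α : Fin n → Fin 3) (i j : Fin n) (h : {i, j} ∈ I.constraints),
      I.allows i j (α i) (α j) = I.pred {i, j} h fun v _ => α v := by
    intro α i j h
    unfold CSP.allows
    rw [dif_pos h]
    congr 1
    funext v hv
    by_cases hv' : v = i
    · subst hv'; simp
    · obtain rfl : v = j := by simpa [hv'] using hv
      simp [hv']
  refine exists_congr fun α => ?_
  constructor
  · rintro ⟨-, h⟩ C hC
    obtain ⟨i, j, -, rfl⟩ := Finset.card_eq_two.1 (I.card_eq C hC)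
    rw [← key]
    exact h i j
  · refine fun h => ⟨fun v => Finset.mem_univ _, fun i j => ?_⟩
    by_cases hC : {i, j} ∈ I.constraints
    · rw [key α i j hC]
      exact h _ hC
    · unfold CSP.allows
      rw [dif_neg hC]

end CompleteCSP

open CompleteCSP in
theorem mainTheorem3 :
    ∃ (M : Turing.TM2ComputableAux Bool Bool) (T : ℕ → ℕ) (c : ℝ),
      (∀ k : M.tm.K, Finite (M.tm.Γ k)) ∧
      (∀ n : ℕ, 2 ≤ n → (T n : ℝ) ≤ (n : ℝ) ^ (c * Real.log n)) ∧
      ∀ (n : ℕ) (I : CSP 2 3 n), I.IsComplete →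
        ∃ b : Bool, OutputsBitInTime M I.encode b (T n) ∧ (b = true ↔ I.Satisfiable) := by
  classical
  refine ⟨⟨machine (Γ := Alphabet) Stack.inp Stack.out Reg.init mainProg, Equiv.refl Bool,
    Equiv.refl Bool⟩, mainTime, 27 / Real.log 2, ?_, fun n hn => ?_, fun n I hI => ?_⟩
  · rintro (_ | _ | _ | _ | _)
    · exact inferInstanceAs (Finite Bool)
    · exact inferInstanceAs (Finite Bool)
    · exact inferInstanceAs (Finite Rec)
    · exact inferInstanceAs (Finite Rec)
    · exact inferInstanceAs (Finite Dom)
  · have hlog : (Nat.log 2 n : ℝ) ≤ Real.log n / Real.log 2 := by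
      simpa [Real.logb] using Real.natLog_le_logb n 2
    calc (mainTime n : ℝ) ≤ ((n ^ (27 * Nat.log 2 n) : ℕ) : ℝ) := by
          exact_mod_cast mainTime_le hn
      _ = (n : ℝ) ^ ((27 * Nat.log 2 n : ℕ) : ℝ) := by rw [Real.rpow_natCast]; push_cast; rfl
      _ ≤ (n : ℝ) ^ (27 / Real.log 2 * Real.log n) := by
          apply Real.rpow_le_rpow_of_exponent_le
          · exact_mod_cast (by omega : 1 ≤ n)
          · push_cast
            rw [div_mul_eq_mul_div, mul_div_assoc]
            gcongr
  · refine ⟨decide (Solvable I.allows fun _ => Finset.univ), ?_, by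
      rw [decide_eq_true_iff]; exact solvable_allows_iff I⟩
    have h := runs_mainProg (R := I.allows) (allows_symm I) fun i j hij =>
      exists_not_allows hI hij
    have hmem : ∀ (s : Mem) (k : Stack) (y : List (Alphabet k)), s.stk k = y →
        (∀ j, j ≠ k → s.stk j = []) → s.stk = Function.update (fun _ => []) k y := by
      intro s k y hk hj
      funext j
      by_cases h : j = k
      · subst h; simp [hk]
      · simp [h, hj j h]
    have hx : ∀ l : List Bool, l.map (Equiv.refl Bool).symm = l := List.map_id
    change Nonempty (Turing.TM2OutputsInTime (machine Stack.inp Stack.out Reg.init mainProg)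
      (I.encode.map (Equiv.refl Bool).symm) (some [_]) _)
    rw [hx]
    refine machine_outputs _ _ _ _ _ _ _ ?_
    unfold Runs at h
    rw [hmem { emptyMem with inp := _ } Stack.inp _ rfl
        (by rintro (_ | _) hj <;> first | rfl | exact absurd rfl hj),
      hmem { emptyMem with out := _ } Stack.out _ rfl
        (by rintro (_ | _) hj <;> first | rfl | exact absurd rfl hj)] at h
    exact h
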